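/- Let $k=\mathbf F_q$ be a finite field, $F=k(\!(\epsilon)\!)$, $\mathcal O=k[\![\epsilon]\!]$, $G=\mathrm{GL}_2$, $K=G(\mathcal O)$, and let $T$ be the diagonal torus of $G$. Let $dg$, $dt$ be the Haar measures on $G(F)$, $T(F)$ with $dg(K)=dt(T(\mathcal O))=1$, and let $dg/dt$ be the quotient measure on $T(F)\backslash G(F)$. Let $\gamma=\mathrm{diag}(\gamma_1,\gamma_2)$ with $\gamma_1,\gamma_2\in\mathcal O$ and $\mathrm{val}(\gamma_1-\gamma_2)=n$, where $n\ge 0$ is an integer (a split regular element of root valuation $n$). Let $\mathscr X=G(F)/K$ and $\mathscr X_\gamma=\{gK\in\mathscr X:\mathrm{Ad}(g)^{-1}\gamma\in\mathfrak g(\mathcal O)\}$. Let $\nu_G(gK)=\mathrm{val}(\det g)\in\mathbf Z$. Identify $X_*(T)$ with $\mathbf Z^2$ and $\mathfrak a_T=X_*(T)\otimes\mathbf R$ with $\mathbf R^2$, let $\mathfrak a_T^G\subset\mathfrak a_T$ be the subspace of vectors with coordinate sum $0$, and let $\pi:\mathfrak a_T\to\mathfrak a_T^G$ be the projection along the line $\mathbf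 R(1,1)$. For $w$ in the Weyl group $W=\mathfrak S_2$ let $N_w=wNw^{-1}$, where $N$ is the group of upper triangular unipotent matrices. By the Iwasawa decomposition each $x\in\mathscr X$ can be written as $x=u\,\mathrm{diag}(t_1,t_2)K$ with $u\in N_w(F)$ and $\mathrm{diag}(t_1,t_2)\in T(F)$; put $H_w(x)=\pi(\mathrm{val}(t_1),\mathrm{val}(t_2))$, which depends only on $x$ and $w$, and let $\mathrm{Ec}(x)\subset\mathfrak a_T^G$ be the convex hull of the $H_w(x)$, $w\in W$. 1. The orbital integral is $$I_\gamma^G=\int_{T(F)\backslash G(F)}\mathbf 1_{\mathfrak g(\mathcal O)}(\mathrm{Ad}(g)^{-1}\gamma)\,\frac{dg}{dt}=q^n.$$ 2. Let $x_0=g_0K\in\mathscr X_\gamma$ be any regular point (i.e. the reduction of $\mathrm{Ad}(g_0)^{-1}\gamma$ modulo $\epsilon$ is a regular element of $\mathfrak g(k)$) with $\nu_G(x_0)=0$. Let $a\in\mathbf N$, and let $\Pi\subset\mathfrak a_T^G$ be the convex hull of the points $H_w(x_0)+w(a\alpha_{12}^\vee)$, $w\in W$, where $\alpha_{12}^\vee=(1,-1)$.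 Then $$Q_\gamma^0(a)=\big|\{x\in\mathscr X_\gamma:\nu_G(x)=0,\ \mathrm{Ec}(x)\subset\Pi\}\big|=\sum_{i=0}^n q^i+2a\,q^n.$$ 3. Let $\xi=(\xi_1,\xi_2)\in\mathfrak a_T^G$ be generic, i.e. $\xi_1-\xi_2\notin\mathbf Z$. For $g\in G(F)$ let $\mathrm w_T^\xi(g)$ be the number of $\lambda\in X_*(T)=\mathbf Z^2$ with $\lambda_1+\lambda_2=\nu_G(gK)$ and $\pi(\lambda)+\xi\in\mathrm{Ec}(gK)$. Then the weighted orbital integral is finite and equals $$J_T^\xi(\gamma)=\int_{T(F)\backslash G(F)}\mathbf 1_{\mathfrak g(\mathcal O)}(\mathrm{Ad}(g)^{-1}\gamma)\,\mathrm w_T^\xi(g)\,\frac{dg}{dt}=n\,q^n-\sum_{i=0}^{n-1}q^i.$$ -/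

import Mathlib

open MeasureTheory
open scoped ENNReal LaurentSeries PowerSeries

namespace GL2Split

/-! ### The groups `G(F)`, `K = G(𝒪)`, `T(F)` for `G = GL₂`, `F = k((ε))`, `𝒪 = k[[ε]]` -/

section Groups

variable (k : Type*) [Field k]

/-- `G(F) = GL₂(k((ε)))`, with the topology induced by the `ε`-adic topology of `F`. -/
abbrev GF := GL (Fin 2) k⸨X⸩

noncomputable instance : MeasurableSpace (GF k) := borel _

instance : BorelSpace (GF k) := ⟨rfl⟩

/-- `K = G(𝒪)`, as a subgroup of `G(F)`. -/
noncomputable def K : Subgroup (GF k) :=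
  (Matrix.GeneralLinearGroup.map (n := Fin 2) (algebraMap k⟦X⟧ k⸨X⸩)).range

/-- `T(F)`: the diagonal maximal torus. -/
def T : Subgroup (GF k) where
  carrier := {g | (g : Matrix (Fin 2) (Fin 2) k⸨X⸩).IsDiag}
  one_mem' := by simp [Matrix.isDiag_one]
  mul_mem' := by
    intro a b ha hb i j hij
    simp only [Units.val_mul, Matrix.mul_apply]
    refine Finset.sum_eq_zero fun l _ => ?_
    by_cases h : i = l
    · subst h; rw [hb hij, mul_zero]
    · rw [ha h, zero_mul]
  inv_mem' := by
    intro a ha i j hij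
    rw [Matrix.coe_units_inv, ← ha.diagonal_diag, Matrix.inv_diagonal]
    exact Matrix.diagonal_apply_ne _ hij

/-- `T(𝒪) = T(F) ∩ G(𝒪)`. -/
noncomputable def TO : Subgroup (T k) := (K k).subgroupOf (T k)

/-- The affine Grassmannian (its set of `k`-points) `G(F)/K`. -/
abbrev Grassmannian := GF k ⧸ K k

/-- The space `T(F)\G(F)` of cosets `T(F) g`, with the quotient of the Borel `σ`-algebra. -/
abbrev TorusQuotient := Quotient (QuotientGroup.rightRel (T k))

end Groups

variable {k : Type*} [Field k]

/-! ### Integration on `T(F)\G(F)` -/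

/-- `μ` is the quotient of `dg` by `dt`: for every Borel `f ≥ 0` on `G(F)`,
`∫_G f dg = ∫_{T\G} (∫_T f(tg) dt) dμ(Tg)`.
Here `φ` is the function `Tg ↦ ∫_T f(tg) dt`. -/
def IsQuotientMeasure (dg : Measure (GF k)) (dt : Measure (T k))
    (μ : Measure (TorusQuotient k)) : Prop :=
  ∀ f : GF k → ℝ≥0∞, Measurable f → ∀ φ : TorusQuotient k → ℝ≥0∞,
    (∀ g : GF k, φ (Quotient.mk _ g) = ∫⁻ t : T k, f ((t : GF k) * g) ∂dt) →
      ∫⁻ g, f g ∂dg = ∫⁻ x, φ x ∂μ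

open Classical in
/-- The quotient measure `dg/dt` on `T(F)\G(F)`. -/
noncomputable def quotientMeasure (dg : Measure (GF k)) (dt : Measure (T k)) :
    Measure (TorusQuotient k) :=
  if h : ∃ μ, IsQuotientMeasure dg dt μ then h.choose else 0

/-- `∫_{T(F)\G(F)} f(g) dg/dt` for a function `f ≥ 0` on `G(F)` that is invariant under left
translation by `T(F)` (so that the choice of representatives does not matter). -/
noncomputable def torusIntegral (dg : Measure (GF k)) (dt : Measure (T k))
    (f : GF k → ℝ≥0∞) : ℝ≥0∞ :=
  ∫⁻ x : TorusQuotient k, f (Quotient.out x) ∂(quotientMeasure dg dt)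

/-! ### Orbital integral and affine Springer fiber -/

/-- `Ad(g)⁻¹ γ`, for `γ ∈ 𝔤(𝒪)` regarded in `𝔤(F)`. -/
noncomputable def adInv (g : GF k) (γ : Matrix (Fin 2) (Fin 2) k⟦X⟧) :
    Matrix (Fin 2) (Fin 2) k⸨X⸩ :=
  ((g⁻¹ : GF k) : Matrix (Fin 2) (Fin 2) k⸨X⸩) * γ.map (algebraMap k⟦X⟧ k⸨X⸩) *
    (g : Matrix (Fin 2) (Fin 2) k⸨X⸩)

variable (k) in
/-- The lattice `𝔤(𝒪)` in `𝔤(F)`. -/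
def latticeO : Set (Matrix (Fin 2) (Fin 2) k⸨X⸩) :=
  Set.range fun A : Matrix (Fin 2) (Fin 2) k⟦X⟧ => A.map (algebraMap k⟦X⟧ k⸨X⸩)

/-- `{g ∈ G(F) | Ad(g)⁻¹ γ ∈ 𝔤(𝒪)}`. -/
def integralSet (γ : Matrix (Fin 2) (Fin 2) k⟦X⟧) : Set (GF k) :=
  {g | adInv g γ ∈ latticeO k}

/-- The orbital integral `I_γ^G = ∫_{T\G} 1_{𝔤(𝒪)}(Ad(g)⁻¹ γ) dg/dt`. -/
noncomputable def orbitalIntegral (dg : Measure (GF k)) (dt : Measure (T k))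
    (γ : Matrix (Fin 2) (Fin 2) k⟦X⟧) : ℝ≥0∞ :=
  torusIntegral dg dt ((integralSet γ).indicator 1)

/-- The affine Springer fiber `𝒳_γ` (its set of `k`-points). -/
def springerFiber (γ : Matrix (Fin 2) (Fin 2) k⟦X⟧) : Set (Grassmannian k) :=
  {x | ∃ g : GF k, (g : Grassmannian k) = x ∧ g ∈ integralSet γ}

/-- An element of `𝔤𝔩₂(k)` is regular if its centralizer has the minimal dimension,
which is the rank `2`. -/
def IsRegularMatrix (A : Matrix (Fin 2) (Fin 2) k) : Prop :=
  Module.finrank k (Subalgebra.centralizer k ({A} : Set (Matrix (Fin 2) (Fin 2) k))) = 2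

/-- The regular points of `𝒳_γ`: those `gK` for which `Ad(g)⁻¹ γ` lies in `𝔤(𝒪)` and has a
regular image in `𝔤(k)`. -/
def regularPoints (γ : Matrix (Fin 2) (Fin 2) k⟦X⟧) : Set (Grassmannian k) :=
  {x | ∃ g : GF k, (g : Grassmannian k) = x ∧ ∃ A : Matrix (Fin 2) (Fin 2) k⟦X⟧,
    adInv g γ = A.map (algebraMap k⟦X⟧ k⸨X⸩) ∧
      IsRegularMatrix (A.map (PowerSeries.constantCoeff (R := k)))}

/-! ### Connected components -/

lemma order_unit (u : k⟦X⟧ˣ) : (algebraMap k⟦X⟧ k⸨X⸩ (u : k⟦X⟧)).order = 0 := by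
  have key : ∀ a : k⟦X⟧, a ≠ 0 → 0 ≤ (algebraMap k⟦X⟧ k⸨X⸩ a).order := by
    intro a ha
    have h0 : algebraMap k⟦X⟧ k⸨X⸩ a ≠ 0 := by
      rw [LaurentSeries.coe_algebraMap]
      exact fun h => ha (HahnSeries.ofPowerSeries_injective (Γ := ℤ) (by simpa using h))
    by_contra hlt
    push Not at hlt
    have hc := HahnSeries.coeff_order_eq_zero.not.2 h0
    rw [LaurentSeries.coe_algebraMap] at hc hlt
    exact hc (by rw [PowerSeries.coeff_coe, if_pos hlt])
  have h1 := key _ u.ne_zero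
  have h2 := key _ (u⁻¹).ne_zero
  have hu : (algebraMap k⟦X⟧ k⸨X⸩ (u : k⟦X⟧)) * (algebraMap k⟦X⟧ k⸨X⸩ ((u⁻¹ : k⟦X⟧ˣ) : k⟦X⟧)) = 1 := by
    rw [← map_mul, Units.mul_inv, map_one]
  have h3 := congrArg HahnSeries.order hu
  rw [HahnSeries.order_mul (left_ne_zero_of_mul_eq_one hu) (right_ne_zero_of_mul_eq_one hu),
    HahnSeries.order_one] at h3
  omega

/-- `val(det g)`; it is the canonical homomorphism `G(F) → Λ_G`, where
`Λ_G = X_*(T)/(coroot lattice) = ℤ² / ℤ(1,-1)` is identified with `ℤ` by `(a, b) ↦ a + b`. -/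
noncomputable def valDet (g : GF k) : ℤ :=
  (g : Matrix (Fin 2) (Fin 2) k⸨X⸩).det.order

lemma valDet_mul_K (g : GF k) {c : GF k} (hc : c ∈ K k) : valDet (g * c) = valDet g := by
  obtain ⟨d, rfl⟩ := hc
  have hdet : ((Matrix.GeneralLinearGroup.map (algebraMap k⟦X⟧ k⸨X⸩) d : GF k) :
      Matrix (Fin 2) (Fin 2) k⸨X⸩).det =
      algebraMap k⟦X⟧ k⸨X⸩ ((Matrix.GeneralLinearGroup.det d : k⟦X⟧ˣ) : k⟦X⟧) := by
    rw [Matrix.GeneralLinearGroup.val_det_apply, RingHom.map_det]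
    rfl
  have hg : (g : Matrix (Fin 2) (Fin 2) k⸨X⸩).det ≠ 0 :=
    (Matrix.isUnits_det_units g).ne_zero
  have hd := (Matrix.isUnits_det_units
    (Matrix.GeneralLinearGroup.map (n := Fin 2) (algebraMap k⟦X⟧ k⸨X⸩) d)).ne_zero
  unfold valDet
  rw [Units.val_mul, Matrix.det_mul, HahnSeries.order_mul hg hd, hdet, order_unit, add_zero]

/-- The map `ν_G : 𝒳 → Λ_G = ℤ`, whose fibers are the connected components `𝒳^ν`. -/
noncomputable def nuG : Grassmannian k → ℤ :=
  Quotient.lift valDet (by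
    intro a b hab
    have h : a⁻¹ * b ∈ K k := QuotientGroup.leftRel_apply.1 hab
    have := valDet_mul_K a h
    rw [mul_inv_cancel_left] at this
    exact this.symm)

/-! ### Polytopes in `𝔞_T^G`

The Weyl group is `Equiv.Perm (Fin 2)`; the elements of `𝒫(T)` are the Borel subgroups `w B₀`,
where `B₀` is the group of upper triangular matrices. `X_*(T) = ℤ²`, `𝔞_T = ℝ²`, and `𝔞_T^G` is
the subspace of vectors with coordinate sum `0`. -/

/-- The unipotent radical `N_w` of `w B₀`, i.e. `w N w⁻¹` for the group `N` of upper triangular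
unipotent matrices. -/
def unipotent (w : Equiv.Perm (Fin 2)) : Set (GF k) :=
  {u | (∀ i, (u : Matrix (Fin 2) (Fin 2) k⸨X⸩) i i = 1) ∧
    (u : Matrix (Fin 2) (Fin 2) k⸨X⸩) (w 1) (w 0) = 0}

/-- The map `T(F) → X_*(T)` that sends `χ(ε) t₀` to `χ`, for `t₀ ∈ T(𝒪)`. -/
noncomputable def valT (t : T k) : Fin 2 → ℤ :=
  fun i => (((t : GF k) : Matrix (Fin 2) (Fin 2) k⸨X⸩) i i).order

/-- The retraction `f_P : 𝒳 → 𝒳^T = X_*(T)` for `P = w B₀`: it sends `u t K` to the class of `t`,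
for `u ∈ N_w` and `t ∈ T(F)` (by the Iwasawa decomposition every point is of this form, and the
class of `t` is unique). -/
noncomputable def retraction (w : Equiv.Perm (Fin 2)) (x : Grassmannian k) : Fin 2 → ℤ :=
  Classical.epsilon fun v : Fin 2 → ℤ =>
    ∃ u ∈ unipotent (k := k) w, ∃ t : T k,
      x = ((u * (t : GF k) : GF k) : Grassmannian k) ∧ v = valT t

/-- The map `Λ_T = X_*(T) → 𝔞_T^G`, induced by the projection of `𝔞_T` along `𝔞_G`. -/
noncomputable def toAG (v : Fin 2 → ℤ) : Fin 2 → ℝ :=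
  fun i => (v i : ℝ) - ((v 0 : ℝ) + (v 1 : ℝ)) / 2

/-- `H_P : 𝒳 → 𝔞_T^G` for `P = w B₀`. -/
noncomputable def HP (w : Equiv.Perm (Fin 2)) (x : Grassmannian k) : Fin 2 → ℝ :=
  toAG (retraction w x)

/-- The polytope `Ec(x)`: the convex hull of the `H_P(x)`, `P ∈ 𝒫(T)`. -/
noncomputable def Ec (x : Grassmannian k) : Set (Fin 2 → ℝ) :=
  convexHull ℝ (Set.range fun w : Equiv.Perm (Fin 2) => HP w x)

/-- The action of the Weyl group on `𝔞_T`. -/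
def weylAct (w : Equiv.Perm (Fin 2)) (v : Fin 2 → ℝ) : Fin 2 → ℝ := fun i => v (w⁻¹ i)

/-- The coroot `α₁₂^∨ = (1, -1)`. -/
def coroot : Fin 2 → ℝ := ![1, -1]

/-- The polytope `Π` with vertices `λ_w(Π) = λ_w(Σ) + w(a α₁₂^∨)`, where `Σ = Ec(x₀)` has the
vertices `λ_w(Σ) = H_{w B₀}(x₀)`. -/
noncomputable def truncPolytope (x₀ : Grassmannian k) (a : ℕ) : Set (Fin 2 → ℝ) :=
  convexHull ℝ (Set.range fun w : Equiv.Perm (Fin 2) =>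
    HP w x₀ + weylAct w ((a : ℝ) • coroot))

/-- The component of degree `ν` of the truncated affine Springer fiber:
`𝒳_γ^ν(Π) = {x ∈ 𝒳_γ | ν_G(x) = ν, Ec(x) ⊆ Π}`. -/
def truncatedFiber (γ : Matrix (Fin 2) (Fin 2) k⟦X⟧) (ν : ℤ) (P : Set (Fin 2 → ℝ)) :
    Set (Grassmannian k) :=
  {x | x ∈ springerFiber γ ∧ nuG x = ν ∧ Ec x ⊆ P}

/-! ### The weighted orbital integral -/

/-- `ξ` is a generic element of `𝔞_T^G`: it has coordinate sum `0`, and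
`α₁₂(ξ) ≠ α₁₂(v)` for all `v ∈ X_*(T)`. -/
def IsGenericXi (ξ : Fin 2 → ℝ) : Prop :=
  ξ 0 + ξ 1 = 0 ∧ ∀ v : Fin 2 → ℤ, ξ 0 - ξ 1 ≠ ((v 0 - v 1 : ℤ) : ℝ)

/-- The weight factor `w_T^ξ(g)`: the number of `v ∈ X_*(T)`, with the same image in `Λ_G` as `g`,
such that `v + ξ ∈ Ec([g])`. -/
noncomputable def weight (ξ : Fin 2 → ℝ) (g : GF k) : ℝ≥0∞ :=
  (({v : Fin 2 → ℤ | v 0 + v 1 = nuG (g : Grassmannian k) ∧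
    toAG v + ξ ∈ Ec (g : Grassmannian k)}.encard : ℕ∞) : ℝ≥0∞)

/-- The weighted orbital integral
`J_T^ξ(γ) = ∫_{T\G} 1_{𝔤(𝒪)}(Ad(g)⁻¹ γ) w_T^ξ(g) dg/dt`. -/
noncomputable def weightedOrbitalIntegral (dg : Measure (GF k)) (dt : Measure (T k))
    (ξ : Fin 2 → ℝ) (γ : Matrix (Fin 2) (Fin 2) k⟦X⟧) : ℝ≥0∞ :=
  torusIntegral dg dt ((integralSet γ).indicator (weight ξ))

end GL2Split

/-!
Everything is read off from the Iwasawa decomposition `G(F) = T(F) N(F) K`. Write `n(y)` for the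
upper triangular unipotent matrix with entry `y`, and let `m(y) = max(0, -val y)` be the pole order
of `y ∈ F`, which depends only on the class of `y` in `F / 𝒪`.

*Points.* Every point of the affine Grassmannian is `diag(ε^a, ε^b) n(y) K`, with unique `a`, `b`
and a unique class of `y` in `F / 𝒪`. As `Ad(n(y))⁻¹ γ` is upper triangular with off-diagonal
entry `y (γ₁ - γ₂)`, the point lies in the affine Springer fiber iff `m(y) ≤ n`
(`unip_mem_integralSet`), and it can be regular only if `m(y) = n` (`exists_of_mem_regularPoints`).
If `y` has a pole, then `n(y) ∈ N₋(F) diag(y, -y⁻¹) K`; so the two retractions of the point are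
`(a, b)` and `(a - m(y), b + m(y))` (`retraction_one`, `retraction_swap`), and for `a + b = 0` the
polytope `Ec` is the segment from `a - m(y)` to `a` (`Ec_cochar`). The truncated fiber thus consists
of the pairs `(a, y)` with `m(y) ≤ n` for which this segment lies in a fixed segment of length
`n + 2A`, where `A` is the truncation parameter: there are `n + 2A + 1 - m(y)` values of `a` for
each class `y` (`encard_truncatedFiber`).

*Integrals.* The characteristic function of `N(F) K` has integral `1` along every coset `T(F) g`.
By Tonelli and the invariance of the two measures, the image of `dg` restricted to `N(F) K` is a
quotient measure (`exists_isQuotientMeasure`). For any quotient measure, the integral over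
`T(F)\G(F)` of a left `T(F)`-invariant function is its integral over `N(F) K`
(`torusIntegral_eq_lintegral`), hence a sum over `N(F) K / K = F / 𝒪` if the function is also right
`K`-invariant (`torusIntegral_eq_sum`). The orbital integral is therefore the number `qⁿ` of classes
with `m(y) ≤ n`. For generic `ξ` the weight of `n(y)` is the lattice length `m(y)` of its segment
(`weight_unip`), so that the weighted orbital integral is the sum of the `m(y)` over these classes.

*Counting.* Both remaining formulas follow from `∑ m(y) = n qⁿ - ∑_{j < n} q^j`, the sum being over
the classes with `m(y) ≤ n` (`sum_poleOrder`).
-/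

namespace GL2Split

/-! ### The valuation ring and pole orders -/

section Ring

variable {k : Type*} [Field k]

variable (k) in
/-- The valuation ring `𝒪 = k[[ε]]`, as a subring of `F = k((ε))`. -/
noncomputable def integerRing : Subring k⸨X⸩ := (algebraMap k⟦X⟧ k⸨X⸩).range

lemma algebraMap_mem_integerRing (a : k⟦X⟧) : algebraMap k⟦X⟧ k⸨X⸩ a ∈ integerRing k := ⟨a, rfl⟩

lemma mem_integerRing_iff_val {x : k⸨X⸩} : x ∈ integerRing k ↔ Valued.v x ≤ 1 := by
  rw [LaurentSeries.val_le_one_iff_eq_coe]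
  exact Iff.rfl

lemma mem_integerRing_iff_coeff {x : k⸨X⸩} : x ∈ integerRing k ↔ ∀ i < 0, x.coeff i = 0 := by
  rw [mem_integerRing_iff_val, ← WithZero.exp_zero, ← neg_zero,
    LaurentSeries.valuation_le_iff_coeff_lt_eq_zero, neg_zero]

/-- The order of the pole of `x` at `ε = 0`; it is `0` if `x` is integral. -/
noncomputable def poleOrder (x : k⸨X⸩) : ℕ := (-x.order).toNat

lemma poleOrder_le_iff {x : k⸨X⸩} {m : ℕ} :
    poleOrder x ≤ m ↔ ∀ i < -(m : ℤ), x.coeff i = 0 := by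
  unfold poleOrder
  by_cases hx : x = 0
  · simp [hx]
  · rw [← HahnSeries.le_order_iff_forall hx]
    omega

lemma poleOrder_eq_zero_iff {x : k⸨X⸩} : poleOrder x = 0 ↔ x ∈ integerRing k := by
  rw [← Nat.le_zero, poleOrder_le_iff, mem_integerRing_iff_coeff]
  simp

lemma mem_integerRing_iff_order {x : k⸨X⸩} : x ∈ integerRing k ↔ 0 ≤ x.order := by
  rw [← poleOrder_eq_zero_iff, poleOrder]
  omega

lemma poleOrder_add_of_mem {x y : k⸨X⸩} (hy : y ∈ integerRing k) :
    poleOrder (x + y) = poleOrder x := by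
  refine eq_of_forall_ge_iff fun m => ?_
  rw [poleOrder_le_iff, poleOrder_le_iff]
  refine forall₂_congr fun i hi => ?_
  rw [HahnSeries.coeff_add, mem_integerRing_iff_coeff.1 hy i (by omega), add_zero]

lemma order_inv {x : k⸨X⸩} (hx : x ≠ 0) : x⁻¹.order = -x.order := by
  have h := HahnSeries.order_mul hx (inv_ne_zero hx)
  rw [mul_inv_cancel₀ hx, HahnSeries.order_one] at h
  omega

lemma div_mem_integerRing {x y : k⸨X⸩} (hy : y ≠ 0) (h : x ≠ 0 → y.order ≤ x.order) :
    x / y ∈ integerRing k := by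
  by_cases hx : x = 0
  · rw [hx, zero_div]; exact zero_mem _
  · rw [div_eq_mul_inv, mem_integerRing_iff_order, HahnSeries.order_mul hx (inv_ne_zero hy),
      order_inv hy]
    linarith [h hx]

lemma order_le_order_mul {x y : k⸨X⸩} (hxy : x * y ≠ 0) (hy : y ∈ integerRing k) :
    x.order ≤ (x * y).order := by
  rw [HahnSeries.order_mul (left_ne_zero_of_mul hxy) (right_ne_zero_of_mul hxy)]
  linarith [mem_integerRing_iff_order.1 hy]

lemma algebraMap_injective : Function.Injective (algebraMap k⟦X⟧ k⸨X⸩) :=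
  IsFractionRing.injective k⟦X⟧ k⸨X⸩

lemma order_algebraMap {a : k⟦X⟧} {n : ℕ} (h : a.order = n) :
    (algebraMap k⟦X⟧ k⸨X⸩ a).order = n := by
  have ha : a ≠ 0 := by
    rintro rfl
    simp at h
  have h0 : algebraMap k⟦X⟧ k⸨X⸩ a ≠ 0 := (map_ne_zero_iff _ algebraMap_injective).2 ha
  obtain ⟨h1, h2⟩ := PowerSeries.order_eq_nat.1 h
  refine le_antisymm (HahnSeries.order_le_of_coeff_ne_zero ?_)
    ((HahnSeries.le_order_iff_forall h0).2 fun i hi => ?_)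
  · rw [LaurentSeries.coe_algebraMap, PowerSeries.coeff_coe]
    simpa using h1
  · rw [LaurentSeries.coe_algebraMap, PowerSeries.coeff_coe]
    split_ifs with h3
    · rfl
    · exact h2 _ (by omega)

lemma mul_mem_integerRing_iff {δ : k⟦X⟧} {n : ℕ} (h : δ.order = n) (y : k⸨X⸩) :
    y * algebraMap k⟦X⟧ k⸨X⸩ δ ∈ integerRing k ↔ poleOrder y ≤ n := by
  have hδ : algebraMap k⟦X⟧ k⸨X⸩ δ ≠ 0 := by
    refine (map_ne_zero_iff _ algebraMap_injective).2 ?_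
    rintro rfl
    simp at h
  by_cases hy : y = 0
  · simp [hy, poleOrder, zero_mem]
  · rw [mem_integerRing_iff_order, HahnSeries.order_mul hy hδ, order_algebraMap h, poleOrder]
    omega

/-- The polar Laurent polynomial `∑ cᵢ ε^{-i-1}`. For `c` in `kⁿ` these represent the classes of
`ε^{-n}𝒪 / 𝒪`. -/
noncomputable def polarPart {n : ℕ} (c : Fin n → k) : k⸨X⸩ :=
  ∑ i : Fin n, HahnSeries.single (-((i : ℕ) : ℤ) - 1) (c i)

lemma coeff_polarPart {n : ℕ} (c : Fin n → k) (j : Fin n) :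
    (polarPart c).coeff (-(j : ℤ) - 1) = c j := by
  rw [polarPart, HahnSeries.coeff_sum, Finset.sum_eq_single j]
  · simp
  · intro b _ hb
    refine HahnSeries.coeff_single_of_ne fun h => hb (Fin.ext ?_)
    omega
  · simp

lemma coeff_polarPart_of_lt {n : ℕ} (c : Fin n → k) {i : ℤ} (hi : i < -(n : ℤ)) :
    (polarPart c).coeff i = 0 := by
  rw [polarPart, HahnSeries.coeff_sum]
  refine Finset.sum_eq_zero fun j _ => HahnSeries.coeff_single_of_ne ?_
  have := j.2
  omega

lemma poleOrder_polarPart_le_iff {n m : ℕ} (c : Fin n → k) :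
    poleOrder (polarPart c) ≤ m ↔ ∀ i : Fin n, m ≤ i → c i = 0 := by
  rw [poleOrder_le_iff]
  constructor
  · intro h i hi
    rw [← coeff_polarPart c i]
    exact h _ (by omega)
  · intro h i hi
    by_cases h' : i < -(n : ℤ)
    · exact coeff_polarPart_of_lt c h'
    · have hj := coeff_polarPart c ⟨(-i - 1).toNat, by omega⟩
      rw [h _ (by simp only; omega)] at hj
      rw [← hj]
      congr 1
      simp only
      omega

lemma poleOrder_polarPart_le {n : ℕ} (c : Fin n → k) : poleOrder (polarPart c) ≤ n :=
  (poleOrder_polarPart_le_iff c).2 fun i hi => absurd i.2 (by omega)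

lemma polarPart_inj {n : ℕ} {c d : Fin n → k}
    (h : polarPart c - polarPart d ∈ integerRing k) : c = d := by
  funext j
  have hj := mem_integerRing_iff_coeff.1 h (-(j : ℤ) - 1) (by omega)
  rwa [HahnSeries.coeff_sub, coeff_polarPart, coeff_polarPart, sub_eq_zero] at hj

lemma exists_polarPart {n : ℕ} {y : k⸨X⸩} (hy : poleOrder y ≤ n) :
    ∃ c : Fin n → k, y - polarPart c ∈ integerRing k := by
  refine ⟨fun i => y.coeff (-(i : ℤ) - 1), mem_integerRing_iff_coeff.2 fun i hi => ?_⟩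
  rw [HahnSeries.coeff_sub, sub_eq_zero]
  by_cases h' : i < -(n : ℤ)
  · rw [coeff_polarPart_of_lt _ h', poleOrder_le_iff.1 hy i h']
  · have hj := coeff_polarPart (fun i : Fin n => y.coeff (-(i : ℤ) - 1))
      ⟨(-i - 1).toNat, by omega⟩
    have e : -(((-i - 1).toNat : ℕ) : ℤ) - 1 = i := by omega
    simp only [e] at hj
    exact hj.symm

/-- There are `q^j` polar parts in `ε^{-n}𝒪 / 𝒪` with pole order at most `j`. -/
lemma card_poleOrder_le [Fintype k] {n j : ℕ} (hj : j ≤ n) [DecidableEq k] :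
    (Finset.univ.filter fun c : Fin n → k => poleOrder (polarPart c) ≤ j).card =
      Fintype.card k ^ j := by
  obtain ⟨m, rfl⟩ := Nat.exists_eq_add_of_le hj
  rw [← Fintype.card_fin j, ← Fintype.card_fun, Fintype.card_fin, ← Finset.card_univ]
  refine Finset.card_bij' (fun c _ i => c (Fin.castAdd m i))
    (fun c _ => Fin.append c 0) (by simp) ?_ ?_ ?_
  · intro c _
    simp only [Finset.mem_filter, Finset.mem_univ, true_and, poleOrder_polarPart_le_iff]
    intro i hi
    induction i using Fin.addCases with
    | left i => simp at hi; omega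
    | right i => simp
  · intro c hc
    simp only [Finset.mem_filter, Finset.mem_univ, true_and, poleOrder_polarPart_le_iff] at hc
    funext i
    induction i using Fin.addCases with
    | left i => simp
    | right i => simp [hc (Fin.natAdd j i) (by simp)]
  · intro c _
    funext i
    simp

/-- Summation by layers: `∑ poleOrder = ∑_{j < n} #{poleOrder > j} = ∑_{j < n} (qⁿ - q^j)`. -/
lemma sum_poleOrder [Fintype k] (n : ℕ) :
    ∑ c : Fin n → k, poleOrder (polarPart c) + ∑ j ∈ Finset.range n, Fintype.card k ^ j =
      n * Fintype.card k ^ n := by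
  classical
  have h1 : ∀ c : Fin n → k, poleOrder (polarPart c) +
      ∑ j ∈ Finset.range n, (if poleOrder (polarPart c) ≤ j then 1 else 0) = n := by
    intro c
    rw [← Finset.card_filter]
    have : (Finset.range n).filter (fun j => poleOrder (polarPart c) ≤ j) =
        Finset.Ico (poleOrder (polarPart c)) n := by
      ext j; simp; omega
    rw [this, Nat.card_Ico]
    have := poleOrder_polarPart_le c
    omega
  have h2 : ∑ j ∈ Finset.range n, Fintype.card k ^ j =
      ∑ c : Fin n → k, ∑ j ∈ Finset.range n, (if poleOrder (polarPart c) ≤ j then 1 else 0) := by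
    rw [Finset.sum_comm]
    refine Finset.sum_congr rfl fun j hj => ?_
    rw [← Finset.card_filter, card_poleOrder_le (Finset.mem_range.1 hj).le]
  rw [h2, ← Finset.sum_add_distrib, Finset.sum_congr rfl fun c _ => h1 c]
  simp [mul_comm]

end Ring

/-! ### The subgroups `K`, `T`, `N` and the Iwasawa decomposition -/

section Iwasawa

variable {k : Type*} [Field k]

lemma mem_latticeO_iff {M : Matrix (Fin 2) (Fin 2) k⸨X⸩} :
    M ∈ latticeO k ↔ ∀ i j, M i j ∈ integerRing k := by
  constructor
  · rintro ⟨A, rfl⟩ i j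
    exact algebraMap_mem_integerRing _
  · intro h
    choose A hA using h
    exact ⟨Matrix.of A, by ext1 i j; exact hA i j⟩

lemma mul_mem_latticeO {M N : Matrix (Fin 2) (Fin 2) k⸨X⸩} (hM : M ∈ latticeO k)
    (hN : N ∈ latticeO k) : M * N ∈ latticeO k := by
  obtain ⟨A, rfl⟩ := hM
  obtain ⟨B, rfl⟩ := hN
  exact ⟨A * B, by simp only [Matrix.map_mul]⟩

lemma coe_mem_latticeO {g : GF k} (hg : g ∈ K k) :
    (g : Matrix (Fin 2) (Fin 2) k⸨X⸩) ∈ latticeO k := by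
  obtain ⟨d, rfl⟩ := hg
  exact ⟨d, rfl⟩

lemma valDet_of_mem_K {g : GF k} (hg : g ∈ K k) : valDet g = 0 := by
  have h := valDet_mul_K 1 hg
  rw [one_mul] at h
  rw [h]
  simp [valDet]

lemma mem_K_of_valDet {g : GF k} (hg : (g : Matrix (Fin 2) (Fin 2) k⸨X⸩) ∈ latticeO k)
    (hdet : valDet g = 0) : g ∈ K k := by
  obtain ⟨A, hA⟩ := hg
  have hA : A.map (algebraMap k⟦X⟧ k⸨X⸩) = (g : Matrix (Fin 2) (Fin 2) k⸨X⸩) := hA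
  have h0 : algebraMap k⟦X⟧ k⸨X⸩ A.det = (g : Matrix (Fin 2) (Fin 2) k⸨X⸩).det := by
    rw [← hA, RingHom.map_det]
    rfl
  have hne : (g : Matrix (Fin 2) (Fin 2) k⸨X⸩).det ≠ 0 := (Matrix.isUnits_det_units g).ne_zero
  have hinv : ((g : Matrix (Fin 2) (Fin 2) k⸨X⸩).det)⁻¹ ∈ integerRing k := by
    rw [mem_integerRing_iff_order, order_inv hne]
    unfold valDet at hdet
    omega
  obtain ⟨b, hb⟩ := hinv
  have hu : IsUnit A.det := by
    refine IsUnit.of_mul_eq_one b (algebraMap_injective ?_)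
    rw [map_mul, h0, hb, mul_inv_cancel₀ hne, map_one]
  refine ⟨Matrix.GeneralLinearGroup.mk'' A hu, Units.ext ?_⟩
  rw [← hA]
  rfl

lemma mem_K_iff {g : GF k} : g ∈ K k ↔
    (g : Matrix (Fin 2) (Fin 2) k⸨X⸩) ∈ latticeO k ∧ valDet g = 0 :=
  ⟨fun h => ⟨coe_mem_latticeO h, valDet_of_mem_K h⟩, fun h => mem_K_of_valDet h.1 h.2⟩

lemma valDet_mul (g h : GF k) : valDet (g * h) = valDet g + valDet h := by
  unfold valDet
  rw [Units.val_mul, Matrix.det_mul, HahnSeries.order_mul (Matrix.isUnits_det_units g).ne_zero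
    (Matrix.isUnits_det_units h).ne_zero]

@[simp] lemma nuG_mk (g : GF k) : nuG (g : Grassmannian k) = valDet g := rfl

/-- The upper triangular unipotent matrix `n(y)` with upper right entry `y`. -/
noncomputable def unip (y : k⸨X⸩) : GF k where
  val := !![1, y; 0, 1]
  inv := !![1, -y; 0, 1]
  val_inv := by simp [Matrix.one_fin_two]
  inv_val := by simp [Matrix.one_fin_two]

/-- The lower triangular unipotent matrix with lower left entry `y`. -/
noncomputable def lowerUnip (y : k⸨X⸩) : GF k where
  val := !![1, 0; y, 1]
  inv := !![1, 0; -y, 1]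
  val_inv := by simp [Matrix.one_fin_two]
  inv_val := by simp [Matrix.one_fin_two]

/-- The element `diag(p, s)` of `T(F)`. -/
noncomputable def diagT (p s : k⸨X⸩ˣ) : T k where
  val :=
    { val := !![(p : k⸨X⸩), 0; 0, (s : k⸨X⸩)]
      inv := !![((p⁻¹ : k⸨X⸩ˣ) : k⸨X⸩), 0; 0, ((s⁻¹ : k⸨X⸩ˣ) : k⸨X⸩)]
      val_inv := by simp [Matrix.one_fin_two]
      inv_val := by simp [Matrix.one_fin_two] }
  property := by
    intro i j hij
    fin_cases i <;> fin_cases j <;> simp at hij ⊢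

@[simp] lemma coe_unip (y : k⸨X⸩) :
    (unip y : Matrix (Fin 2) (Fin 2) k⸨X⸩) = !![1, y; 0, 1] := rfl

@[simp] lemma coe_lowerUnip (y : k⸨X⸩) :
    (lowerUnip y : Matrix (Fin 2) (Fin 2) k⸨X⸩) = !![1, 0; y, 1] := rfl

@[simp] lemma coe_diagT (p s : k⸨X⸩ˣ) :
    ((diagT p s : GF k) : Matrix (Fin 2) (Fin 2) k⸨X⸩) = !![(p : k⸨X⸩), 0; 0, (s : k⸨X⸩)] := rfl

lemma exists_eq_diagT (t : T k) : ∃ p s : k⸨X⸩ˣ, t = diagT p s := by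
  have h01 : ((t : GF k) : Matrix (Fin 2) (Fin 2) k⸨X⸩) 0 1 = 0 := t.2 (by simp)
  have h10 : ((t : GF k) : Matrix (Fin 2) (Fin 2) k⸨X⸩) 1 0 = 0 := t.2 (by simp)
  have hdet := (Matrix.isUnits_det_units (t : GF k)).ne_zero
  rw [Matrix.det_fin_two, h01, zero_mul, sub_zero] at hdet
  refine ⟨Units.mk0 _ (left_ne_zero_of_mul hdet), Units.mk0 _ (right_ne_zero_of_mul hdet),
    Subtype.ext (Units.ext ?_)⟩
  refine (Matrix.eta_fin_two ((t : GF k) : Matrix (Fin 2) (Fin 2) k⸨X⸩)).trans ?_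
  rw [h01, h10]
  rfl

lemma T_mul_comm (t s : T k) : t * s = s * t := by
  obtain ⟨p, q, rfl⟩ := exists_eq_diagT t
  obtain ⟨p', q', rfl⟩ := exists_eq_diagT s
  refine Subtype.ext (Units.ext ?_)
  simp [mul_comm]

lemma unip_mul (y z : k⸨X⸩) : unip y * unip z = unip (y + z) := by
  refine Units.ext ?_
  simp [add_comm]

lemma unip_inv (y : k⸨X⸩) : (unip y)⁻¹ = unip (-y) := by
  refine inv_eq_of_mul_eq_one_left ?_
  rw [unip_mul]
  refine Units.ext ?_
  simp [Matrix.one_fin_two]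

lemma diagT_mul_unip (y : k⸨X⸩) (p s : k⸨X⸩ˣ) :
    (diagT p s : GF k) * unip y = unip ((p : k⸨X⸩) * y / (s : k⸨X⸩)) * (diagT p s : GF k) := by
  refine Units.ext ?_
  simp

@[simp] lemma valDet_unip (y : k⸨X⸩) : valDet (unip y) = 0 := by
  simp [valDet]

lemma valDet_diagT (p s : k⸨X⸩ˣ) :
    valDet (diagT p s : GF k) = (p : k⸨X⸩).order + (s : k⸨X⸩).order := by
  simp [valDet, HahnSeries.order_mul]

lemma valT_diagT (p s : k⸨X⸩ˣ) :
    valT (diagT p s) = ![(p : k⸨X⸩).order, (s : k⸨X⸩).order] := by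
  funext i
  fin_cases i <;> simp [valT]

lemma valDet_coe_T (t : T k) : valDet (t : GF k) = valT t 0 + valT t 1 := by
  obtain ⟨p, s, rfl⟩ := exists_eq_diagT t
  simp [valDet_diagT, valT_diagT]

lemma unip_mem_K {y : k⸨X⸩} : unip y ∈ K k ↔ y ∈ integerRing k := by
  rw [mem_K_iff, mem_latticeO_iff]
  simp [Fin.forall_fin_two, one_mem, zero_mem]

lemma diagT_mem_K {p s : k⸨X⸩ˣ} : (diagT p s : GF k) ∈ K k ↔
    (p : k⸨X⸩).order = 0 ∧ (s : k⸨X⸩).order = 0 := by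
  rw [mem_K_iff, mem_latticeO_iff, valDet_diagT]
  simp only [coe_diagT, Fin.forall_fin_two]
  simp [zero_mem, mem_integerRing_iff_order]
  omega

/-- `(c, d) * κ = (0, d')` for some `κ ∈ K` reduces the bottom row; this is the Iwasawa
decomposition `G = T N K`. -/
lemma exists_iwasawa (g : GF k) : ∃ (t : T k) (y : k⸨X⸩), ∃ κ ∈ K k, g = t * unip y * κ := by
  -- It suffices to make `g` upper triangular by right multiplication by an element of `K`.
  suffices h : ∃ κ ∈ K k, ((g * κ : GF k) : Matrix (Fin 2) (Fin 2) k⸨X⸩) 1 0 = 0 by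
    obtain ⟨κ, hκ, h10⟩ := h
    set b := g * κ with hb
    have hdet := (Matrix.isUnits_det_units b).ne_zero
    rw [Matrix.det_fin_two, h10, mul_zero, sub_zero] at hdet
    have h0 := left_ne_zero_of_mul hdet
    refine ⟨diagT (Units.mk0 _ h0) (Units.mk0 _ (right_ne_zero_of_mul hdet)),
      (b : Matrix (Fin 2) (Fin 2) k⸨X⸩) 0 1 / (b : Matrix (Fin 2) (Fin 2) k⸨X⸩) 0 0,
      κ⁻¹, inv_mem hκ, ?_⟩
    rw [eq_mul_inv_iff_mul_eq, ← hb]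
    refine Units.ext ((Matrix.eta_fin_two (b : Matrix (Fin 2) (Fin 2) k⸨X⸩)).trans ?_)
    rw [h10]
    simp [mul_div_cancel₀ _ h0]
  -- The swap of the two columns.
  let σ : GF k := ⟨!![0, 1; 1, 0], !![0, 1; 1, 0], by simp [Matrix.one_fin_two],
    by simp [Matrix.one_fin_two]⟩
  have hσ : σ ∈ K k := by
    rw [mem_K_iff, mem_latticeO_iff]
    simp [σ, Fin.forall_fin_two, zero_mem, one_mem, valDet, HahnSeries.order_neg]
  have hl : ∀ z ∈ integerRing k, lowerUnip z ∈ K k := by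
    intro z hz
    rw [mem_K_iff, mem_latticeO_iff]
    simp [Fin.forall_fin_two, zero_mem, one_mem, valDet, hz]
  set c := (g : Matrix (Fin 2) (Fin 2) k⸨X⸩) 1 0 with hc
  set d := (g : Matrix (Fin 2) (Fin 2) k⸨X⸩) 1 1 with hd
  by_cases hcd : d ≠ 0 ∧ (c ≠ 0 → d.order ≤ c.order)
  · refine ⟨lowerUnip (-(c / d)), hl _ (neg_mem (div_mem_integerRing hcd.1 hcd.2)), ?_⟩
    simp [Matrix.mul_apply, Fin.sum_univ_two, ← hc, ← hd, mul_div_cancel₀ _ hcd.1]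
  · have hdet := (Matrix.isUnits_det_units g).ne_zero
    have hc0 : c ≠ 0 := by
      intro h
      rw [Matrix.det_fin_two, ← hc, ← hd, h] at hdet
      exact hcd ⟨by rintro h'; simp [h'] at hdet, fun h' => absurd h h'⟩
    have hlt : d ≠ 0 → c.order ≤ d.order := by
      intro h
      by_contra hlt
      exact hcd ⟨h, fun _ => by omega⟩
    refine ⟨σ * lowerUnip (-(d / c)), mul_mem hσ (hl _ (neg_mem (div_mem_integerRing hc0 hlt))), ?_⟩
    simp [σ, Matrix.mul_apply, Fin.sum_univ_two, ← hc, ← hd, mul_div_cancel₀ _ hc0]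

/-- The element `diag(ε^a, ε^b)` of `T(F)`. -/
noncomputable def cochar (a b : ℤ) : T k :=
  diagT (Units.mk0 (HahnSeries.single a 1) (by simp)) (Units.mk0 (HahnSeries.single b 1) (by simp))

lemma valT_cochar (a b : ℤ) : valT (cochar a b : T k) = ![a, b] := by
  simp [cochar, valT_diagT, HahnSeries.order_single]

lemma coe_eq_coe_iff {g h : GF k} :
    (g : Grassmannian k) = h ↔ ∃ κ ∈ K k, g * κ = h := by
  rw [QuotientGroup.eq]
  exact ⟨fun H => ⟨_, H, by group⟩, fun ⟨κ, hκ, H⟩ => by simpa [← H] using hκ⟩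

lemma coe_mul_K (g : GF k) {κ : GF k} (hκ : κ ∈ K k) :
    ((g * κ : GF k) : Grassmannian k) = g := (coe_eq_coe_iff.2 ⟨κ, hκ, rfl⟩).symm

lemma coe_mul_unip_eq_iff {g : GF k} {y z : k⸨X⸩} :
    ((g * unip y : GF k) : Grassmannian k) = ((g * unip z : GF k) : Grassmannian k) ↔
      z - y ∈ integerRing k := by
  rw [QuotientGroup.eq, ← unip_mem_K, mul_inv_rev, mul_assoc, inv_mul_cancel_left, unip_inv,
    unip_mul, neg_add_eq_sub]

/-- Every point of the affine Grassmannian is of the form `diag(ε^a, ε^b) n(y) K`. -/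
lemma exists_coe_eq_cochar_mul_unip (g : GF k) : ∃ (a b : ℤ) (y : k⸨X⸩),
    (g : Grassmannian k) = (((cochar a b : T k) * unip y : GF k) : Grassmannian k) := by
  obtain ⟨t, y, κ, hκ, rfl⟩ := exists_iwasawa g
  obtain ⟨p, s, rfl⟩ := exists_eq_diagT t
  -- `diag(p, s) = diag(ε^a, ε^b) t₀` with `t₀ ∈ T(𝒪)`, and `t₀ n(y) = n(y') t₀`.
  have key : ∀ p : k⸨X⸩ˣ, ∃ p₀ : k⸨X⸩ˣ, (p₀ : k⸨X⸩).order = 0 ∧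
      (p : k⸨X⸩) = HahnSeries.single (p : k⸨X⸩).order 1 * (p₀ : k⸨X⸩) := by
    intro p
    have h1 : (HahnSeries.single (p : k⸨X⸩).order (1 : k)) ≠ 0 := by simp
    refine ⟨(Units.mk0 _ h1)⁻¹ * p, ?_, ?_⟩
    · rw [Units.val_mul, HahnSeries.order_mul (Units.ne_zero _) p.ne_zero, Units.val_inv_eq_inv_val,
        Units.val_mk0, order_inv h1, HahnSeries.order_single one_ne_zero, neg_add_cancel]
    · rw [Units.val_mul, Units.val_inv_eq_inv_val, Units.val_mk0, mul_inv_cancel_left₀ h1]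
  obtain ⟨p₀, hp₀, hp⟩ := key p
  obtain ⟨s₀, hs₀, hs⟩ := key s
  have hD : (diagT p s : GF k) =
      (cochar (p : k⸨X⸩).order (s : k⸨X⸩).order : T k) * (diagT p₀ s₀ : GF k) := by
    refine Units.ext ?_
    simp only [cochar, coe_diagT, Units.val_mul, Units.val_mk0, Matrix.mul_fin_two]
    simp [← hp, ← hs]
  refine ⟨(p : k⸨X⸩).order, (s : k⸨X⸩).order, (p₀ : k⸨X⸩) * y / (s₀ : k⸨X⸩), ?_⟩
  rw [coe_mul_K _ hκ, hD, mul_assoc, diagT_mul_unip, ← mul_assoc,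
    coe_mul_K _ (diagT_mem_K.2 ⟨hp₀, hs₀⟩)]

end Iwasawa

/-! ### The retractions and the polytopes `Ec(x)` -/

section Retraction

variable {k : Type*} [Field k]

lemma perm_fin_two_cases (w : Equiv.Perm (Fin 2)) : w = 1 ∨ w = Equiv.swap 0 1 := by
  revert w
  decide

lemma mul_coe_T_apply (u : GF k) (t : T k) (i j : Fin 2) :
    ((u * t : GF k) : Matrix (Fin 2) (Fin 2) k⸨X⸩) i j =
      (u : Matrix (Fin 2) (Fin 2) k⸨X⸩) i j * ((t : GF k) : Matrix (Fin 2) (Fin 2) k⸨X⸩) j j := by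
  obtain ⟨p, s, rfl⟩ := exists_eq_diagT t
  fin_cases j <;> simp [Matrix.mul_apply, Fin.sum_univ_two]

lemma coe_T_apply_ne_zero (t : T k) (i : Fin 2) :
    ((t : GF k) : Matrix (Fin 2) (Fin 2) k⸨X⸩) i i ≠ 0 := by
  obtain ⟨p, s, rfl⟩ := exists_eq_diagT t
  fin_cases i <;> simp

lemma valDet_mul_coe_T {w : Equiv.Perm (Fin 2)} {u : GF k} (hu : u ∈ unipotent w) (t : T k) :
    valDet (u * t : GF k) = valT t 0 + valT t 1 := by
  have h : valDet u = 0 := by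
    obtain ⟨h1, h2⟩ := hu
    unfold valDet
    rw [Matrix.det_fin_two, h1, h1]
    rcases perm_fin_two_cases w with rfl | rfl <;> simp at h2 <;> simp [h2]
  rw [valDet_mul, h, zero_add, valDet_coe_T]

/-- In `u t κ = u' t'` the row of index `w 1` of `u t` is `(0, t_{w 1})`, so `t'_{w 1}` is a
multiple of `t_{w 1}` by an element of `𝒪`. -/
lemma valT_le_of_coe_eq {w : Equiv.Perm (Fin 2)} {u u' : GF k} (hu : u ∈ unipotent w)
    (hu' : u' ∈ unipotent w) {t t' : T k}
    (h : ((u * t : GF k) : Grassmannian k) = ((u' * t' : GF k) : Grassmannian k)) :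
    valT t (w 1) ≤ valT t' (w 1) := by
  obtain ⟨κ, hκ, hM⟩ := coe_eq_coe_iff.1 h
  have hκ' := mem_latticeO_iff.1 (coe_mem_latticeO hκ)
  have e : ((t' : GF k) : Matrix (Fin 2) (Fin 2) k⸨X⸩) (w 1) (w 1) =
      ((t : GF k) : Matrix (Fin 2) (Fin 2) k⸨X⸩) (w 1) (w 1) *
        (κ : Matrix (Fin 2) (Fin 2) k⸨X⸩) (w 1) (w 1) := by
    have h1 := mul_coe_T_apply u' t' (w 1) (w 1)
    rw [hu'.1, one_mul, ← hM, Units.val_mul, Matrix.mul_apply] at h1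
    rw [← h1, ← Equiv.sum_comp w, Fin.sum_univ_two, mul_coe_T_apply, mul_coe_T_apply, hu.1, hu.2]
    ring
  unfold valT
  rw [e]
  exact order_le_order_mul (e ▸ coe_T_apply_ne_zero t' _) (hκ' _ _)

lemma retraction_mul_coe_T {w : Equiv.Perm (Fin 2)} {u : GF k} (hu : u ∈ unipotent w) (t : T k) :
    retraction w ((u * t : GF k) : Grassmannian k) = valT t := by
  obtain ⟨u', hu', t', hx, hv⟩ := Classical.epsilon_spec
    (p := fun v : Fin 2 → ℤ => ∃ u' ∈ unipotent (k := k) w, ∃ t' : T k,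
      ((u * t : GF k) : Grassmannian k) = ((u' * (t' : GF k) : GF k) : Grassmannian k) ∧
        v = valT t') ⟨valT t, u, hu, t, rfl, rfl⟩
  refine Eq.trans hv ?_
  have h1 : valT t' (w 1) = valT t (w 1) :=
    le_antisymm (valT_le_of_coe_eq hu' hu hx.symm) (valT_le_of_coe_eq hu hu' hx)
  have h2 : valT t 0 + valT t 1 = valT t' 0 + valT t' 1 := by
    rw [← valDet_mul_coe_T hu, ← valDet_mul_coe_T hu', ← nuG_mk, hx, nuG_mk]
  funext i
  rcases perm_fin_two_cases w with rfl | rfl <;> simp at h1 <;> fin_cases i <;> simp <;> omega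

lemma retraction_one (t : T k) (y : k⸨X⸩) :
    retraction 1 ((t * unip y : GF k) : Grassmannian k) = valT t := by
  obtain ⟨p, s, rfl⟩ := exists_eq_diagT t
  rw [diagT_mul_unip]
  refine retraction_mul_coe_T ⟨fun i => ?_, ?_⟩ _
  · fin_cases i <;> simp
  · simp

/-- If `y` has a pole, then `n(y) ∈ N₋ diag(y, -y⁻¹) K` for the lower triangular unipotent group
`N₋`. -/
lemma retraction_swap (t : T k) (y : k⸨X⸩) :
    retraction (Equiv.swap 0 1) ((t * unip y : GF k) : Grassmannian k) =
      ![valT t 0 - poleOrder y, valT t 1 + poleOrder y] := by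
  obtain ⟨p, s, rfl⟩ := exists_eq_diagT t
  by_cases hy : y ∈ integerRing k
  · have h := retraction_mul_coe_T (w := Equiv.swap 0 1) (u := (1 : GF k))
      ⟨by simp, by simp⟩ (diagT p s)
    rw [one_mul] at h
    rw [coe_mul_K _ (unip_mem_K.2 hy), h, poleOrder_eq_zero_iff.2 hy, valT_diagT]
    simp
  · have h0 : y ≠ 0 := by
      rintro rfl
      exact hy (zero_mem _)
    have hord : y.order < 0 := by
      rw [mem_integerRing_iff_order] at hy
      omega
    set Y := Units.mk0 y h0 with hY
    let κ : GF k := ⟨!![0, 1; 1, -y⁻¹], !![y⁻¹, 1; 1, 0], by simp [Matrix.one_fin_two],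
      by simp [Matrix.one_fin_two]⟩
    have hκ : κ ∈ K k := by
      rw [mem_K_iff, mem_latticeO_iff]
      simp [κ, Fin.forall_fin_two, zero_mem, one_mem, valDet, HahnSeries.order_neg,
        mem_integerRing_iff_order (x := y⁻¹), order_inv h0, hord.le]
    have e : (diagT p s * unip y : GF k) * κ =
        lowerUnip ((s : k⸨X⸩) / ((p : k⸨X⸩) * y)) * (diagT (p * Y) (-(s * Y⁻¹)) : GF k) := by
      refine Units.ext ?_
      simp [κ, hY, h0]
    rw [← coe_mul_K _ hκ, e, retraction_mul_coe_T ⟨fun i => ?_, ?_⟩, valT_diagT, valT_diagT]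
    · have : ((poleOrder y : ℕ) : ℤ) = -y.order := by
        rw [poleOrder]
        omega
      rw [this]
      simp [hY, HahnSeries.order_mul, HahnSeries.order_neg, order_inv, h0]
    · simp
    · fin_cases i <;> simp

/-- The segment in `𝔞_T^G` of the points `(b, -b)` with `l ≤ b ≤ r`. -/
def antidiagSegment (l r : ℝ) : Set (Fin 2 → ℝ) := {v | v 1 = -v 0 ∧ l ≤ v 0 ∧ v 0 ≤ r}

lemma antidiagSegment_subset_iff {l r l' r' : ℝ} (h : l ≤ r) :
    antidiagSegment l r ⊆ antidiagSegment l' r' ↔ l' ≤ l ∧ r ≤ r' := by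
  constructor
  · intro H
    exact ⟨(H (a := ![l, -l]) ⟨by simp, by simp, by simpa⟩).2.1,
      (H (a := ![r, -r]) ⟨by simp, by simpa, by simp⟩).2.2⟩
  · rintro ⟨h1, h2⟩ v ⟨h3, h4, h5⟩
    exact ⟨h3, h1.trans h4, h5.trans h2⟩

lemma convexHull_pair_antidiag {l r : ℝ} (h : l ≤ r) :
    convexHull ℝ {![r, -r], ![l, -l]} = antidiagSegment l r := by
  rw [convexHull_pair]
  refine Set.Subset.antisymm ?_ ?_
  · rintro _ ⟨a, b, ha, hb, hab, rfl⟩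
    obtain rfl : b = 1 - a := by linarith
    refine ⟨?_, ?_, ?_⟩
    · simp; ring
    · simp; nlinarith
    · simp; nlinarith
  · rintro v ⟨h1, h2, h3⟩
    have hv : v = ![v 0, -v 0] := by
      funext i
      fin_cases i <;> simp [h1]
    rcases h.eq_or_lt with rfl | hlt
    · have : v 0 = l := le_antisymm h3 h2
      rw [hv, this]
      exact left_mem_segment _ _ _
    · have hne : r - l ≠ 0 := by linarith
      refine ⟨(v 0 - l) / (r - l), (r - v 0) / (r - l), div_nonneg (by linarith) (by linarith),
        div_nonneg (by linarith) (by linarith), by field_simp; ring, ?_⟩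
      funext i
      fin_cases i
      · simp; field_simp; ring
      · simp [h1]; field_simp; ring

lemma convexHull_range_perm (f : Equiv.Perm (Fin 2) → Fin 2 → ℝ) {l r : ℝ} (hlr : l ≤ r)
    (h1 : f 1 = ![r, -r]) (hs : f (Equiv.swap 0 1) = ![l, -l]) :
    convexHull ℝ (Set.range f) = antidiagSegment l r := by
  rw [← convexHull_pair_antidiag hlr, ← h1, ← hs]
  congr 1
  ext v
  constructor
  · rintro ⟨w, rfl⟩
    rcases perm_fin_two_cases w with rfl | rfl <;> simp
  · rintro (rfl | rfl) <;> exact ⟨_, rfl⟩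

lemma HP_one_cochar (a : ℤ) (y : k⸨X⸩) :
    HP 1 (((cochar a (-a) : T k) * unip y : GF k) : Grassmannian k) = ![(a : ℝ), -(a : ℝ)] := by
  rw [HP, retraction_one, valT_cochar]
  funext i
  fin_cases i <;> simp [toAG]

lemma HP_swap_cochar (a : ℤ) (y : k⸨X⸩) :
    HP (Equiv.swap 0 1) (((cochar a (-a) : T k) * unip y : GF k) : Grassmannian k) =
      ![(a : ℝ) - poleOrder y, -((a : ℝ) - poleOrder y)] := by
  rw [HP, retraction_swap, valT_cochar]
  funext i
  fin_cases i <;> simp [toAG]; ring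

lemma Ec_cochar (a : ℤ) (y : k⸨X⸩) :
    Ec (((cochar a (-a) : T k) * unip y : GF k) : Grassmannian k) =
      antidiagSegment ((a : ℝ) - poleOrder y) a :=
  convexHull_range_perm _ (by simp) (HP_one_cochar a y) (HP_swap_cochar a y)

lemma truncPolytope_cochar (a₀ : ℤ) (y : k⸨X⸩) (a : ℕ) :
    truncPolytope (((cochar a₀ (-a₀) : T k) * unip y : GF k) : Grassmannian k) a =
      antidiagSegment ((a₀ : ℝ) - poleOrder y - a) (a₀ + a) := by
  refine convexHull_range_perm _ ?_ ?_ ?_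
  · have h1 : (0 : ℝ) ≤ a := a.cast_nonneg
    have h2 : (0 : ℝ) ≤ poleOrder y := (poleOrder y).cast_nonneg
    linarith
  · rw [HP_one_cochar]
    funext i
    fin_cases i <;> simp [weylAct, coroot]; ring
  · rw [HP_swap_cochar]
    funext i
    fin_cases i <;> simp [weylAct, coroot] <;> ring

lemma retraction_coe_T_mul (w : Equiv.Perm (Fin 2)) (t : T k) (g : GF k) :
    retraction w ((t * g : GF k) : Grassmannian k) =
      valT t + retraction w (g : Grassmannian k) := by
  obtain ⟨t', y, κ, hκ, rfl⟩ := exists_iwasawa g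
  have hv : ∀ t t' : T k, valT (t * t') = valT t + valT t' := by
    intro t t'
    obtain ⟨p, s, rfl⟩ := exists_eq_diagT t
    obtain ⟨p', s', rfl⟩ := exists_eq_diagT t'
    funext i
    fin_cases i <;> simp [valT, HahnSeries.order_mul]
  have h : (t * (t' * unip y * κ) : GF k) = ((t * t' : T k) : GF k) * unip y * κ := by
    simp [mul_assoc]
  rw [h, coe_mul_K _ hκ, coe_mul_K _ hκ]
  rcases perm_fin_two_cases w with rfl | rfl
  · rw [retraction_one, retraction_one, hv]
  · rw [retraction_swap, retraction_swap, hv]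
    funext i
    fin_cases i <;> simp <;> ring

/-- For `g = n(y)` the polytope is a segment of lattice length `poleOrder y`; its translate by a
generic `-ξ` has no lattice point as an end point. -/
lemma weight_unip {ξ : Fin 2 → ℝ} (hξ : IsGenericXi ξ) (y : k⸨X⸩) :
    weight ξ (unip y) = poleOrder y := by
  have hE : Ec (unip y : Grassmannian k) = antidiagSegment (-poleOrder y) 0 := by
    have h := Ec_cochar 0 y
    have h1 : (cochar 0 (-0) : T k) = 1 := by
      refine Subtype.ext (Units.ext ?_)
      simp [cochar, Matrix.one_fin_two]
    rw [h1] at h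
    simpa using h
  have hceil : ⌈-ξ 0⌉ = ⌊-ξ 0⌋ + 1 := by
    rw [Int.ceil_eq_iff]
    push_cast
    refine ⟨?_, (Int.lt_floor_add_one _).le⟩
    rw [add_sub_cancel_right]
    refine lt_of_le_of_ne (Int.floor_le _) fun h => hξ.2 ![-2 * ⌊-ξ 0⌋, 0] ?_
    have := hξ.1
    push_cast
    simp
    linarith
  have hset : {v : Fin 2 → ℤ | v 0 + v 1 = nuG (unip y : Grassmannian k) ∧
      toAG v + ξ ∈ Ec (unip y : Grassmannian k)} =
      (fun j : ℤ => (![j, -j] : Fin 2 → ℤ)) ''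
        (Finset.Icc (⌈-ξ 0⌉ - poleOrder y) ⌊-ξ 0⌋ : Finset ℤ) := by
    ext v
    have hξ' := hξ.1
    simp only [nuG_mk, valDet_unip, hE, antidiagSegment, Set.mem_ofPred_eq, Set.mem_image,
      Finset.coe_Icc, Set.mem_Icc, Pi.add_apply, toAG, tsub_le_iff_right, Int.ceil_le,
      Int.le_floor]
    push_cast
    constructor
    · rintro ⟨h1, h2, h3, h4⟩
      have h1' : (v 1 : ℝ) = -v 0 := by
        rw [eq_neg_iff_add_eq_zero, add_comm]
        exact_mod_cast h1
      rw [h1'] at h3 h4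
      refine ⟨v 0, ⟨by linarith, by linarith⟩, ?_⟩
      funext i
      fin_cases i
      · simp
      · simp; omega
    · rintro ⟨j, ⟨h1, h2⟩, rfl⟩
      simp
      refine ⟨?_, ?_, ?_⟩ <;> linarith
  have hinj : Function.Injective fun j : ℤ => (![j, -j] : Fin 2 → ℤ) :=
    fun i j h => congrFun h 0
  rw [weight, hset, hinj.encard_image, Set.encard_coe_eq_coe_finsetCard, Int.card_Icc, hceil]
  simp

end Retraction

/-! ### The affine Springer fiber -/

section Springer

open scoped Pointwise

variable {k : Type*} [Field k]

lemma weight_coe_T_mul (ξ : Fin 2 → ℝ) (t : T k) (g : GF k) :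
    weight ξ ((t : GF k) * g) = weight ξ g := by
  have hH : ∀ w, HP w ((t * g : GF k) : Grassmannian k) =
      toAG (valT t) + HP w (g : Grassmannian k) := by
    intro w
    rw [HP, HP, retraction_coe_T_mul]
    funext i
    simp [toAG]
    ring
  have hE : Ec ((t * g : GF k) : Grassmannian k) =
      toAG (valT t) +ᵥ Ec (g : Grassmannian k) := by
    rw [Ec, Ec, ← convexHull_vadd]
    congr 1
    ext v
    simp [Set.mem_vadd_set, hH]
  have hset : {v : Fin 2 → ℤ | v 0 + v 1 = nuG ((t * g : GF k) : Grassmannian k) ∧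
      toAG v + ξ ∈ Ec ((t * g : GF k) : Grassmannian k)} =
      (valT t + ·) '' {v : Fin 2 → ℤ | v 0 + v 1 = nuG (g : Grassmannian k) ∧
        toAG v + ξ ∈ Ec (g : Grassmannian k)} := by
    have hA : ∀ v, toAG (valT t + v) + ξ = toAG (valT t) +ᵥ (toAG v + ξ) := by
      intro v
      funext i
      simp [toAG]
      ring
    have hiff : ∀ v, (valT t + v) 0 + (valT t + v) 1 = nuG ((t * g : GF k) : Grassmannian k) ∧
        toAG (valT t + v) + ξ ∈ Ec ((t * g : GF k) : Grassmannian k) ↔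
        v 0 + v 1 = nuG (g : Grassmannian k) ∧ toAG v + ξ ∈ Ec (g : Grassmannian k) := by
      intro v
      rw [hE, hA, Set.vadd_mem_vadd_set_iff, nuG_mk, nuG_mk, valDet_mul, valDet_coe_T]
      refine and_congr ?_ Iff.rfl
      simp only [Pi.add_apply]
      omega
    ext v
    constructor
    · intro hv
      refine ⟨-valT t + v, (hiff _).1 ?_, by simp⟩
      rwa [add_neg_cancel_left]
    · rintro ⟨v, hv, rfl⟩
      exact (hiff v).2 hv
  rw [weight, hset, (add_right_injective _).encard_image, weight]

lemma weight_mul_K (ξ : Fin 2 → ℝ) (g : GF k) {κ : GF k} (hκ : κ ∈ K k) :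
    weight ξ (g * κ) = weight ξ g := by
  rw [weight, coe_mul_K g hκ, weight]

variable {γ : Matrix (Fin 2) (Fin 2) k⟦X⟧}

lemma adInv_mul (g h : GF k) : adInv (g * h) γ =
    ((h⁻¹ : GF k) : Matrix (Fin 2) (Fin 2) k⸨X⸩) * adInv g γ *
      (h : Matrix (Fin 2) (Fin 2) k⸨X⸩) := by
  simp only [adInv, mul_inv_rev, Units.val_mul, Matrix.mul_assoc]

lemma adInv_coe_T (hγ : γ.IsDiag) (t : T k) :
    adInv (t : GF k) γ = γ.map (algebraMap k⟦X⟧ k⸨X⸩) := by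
  have hc : γ.map (algebraMap k⟦X⟧ k⸨X⸩) * ((t : GF k) : Matrix (Fin 2) (Fin 2) k⸨X⸩) =
      ((t : GF k) : Matrix (Fin 2) (Fin 2) k⸨X⸩) * γ.map (algebraMap k⟦X⟧ k⸨X⸩) := by
    obtain ⟨p, s, rfl⟩ := exists_eq_diagT t
    have h01 : γ 0 1 = 0 := hγ (by simp)
    have h10 : γ 1 0 = 0 := hγ (by simp)
    ext i j
    fin_cases i <;> fin_cases j <;>
      simp [Matrix.mul_apply, Fin.sum_univ_two, h01, h10, mul_comm]
  rw [adInv, Matrix.mul_assoc, hc, ← Matrix.mul_assoc, ← Units.val_mul, inv_mul_cancel,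
    Units.val_one, Matrix.one_mul]

lemma adInv_coe_T_mul (hγ : γ.IsDiag) (t : T k) (g : GF k) :
    adInv ((t : GF k) * g) γ = adInv g γ := by
  rw [adInv_mul, adInv_coe_T hγ, adInv]

lemma adInv_unip (hγ : γ.IsDiag) (y : k⸨X⸩) :
    adInv (unip y) γ = !![algebraMap k⟦X⟧ k⸨X⸩ (γ 0 0),
      y * algebraMap k⟦X⟧ k⸨X⸩ (γ 0 0 - γ 1 1); 0, algebraMap k⟦X⟧ k⸨X⸩ (γ 1 1)] := by
  have h01 : γ 0 1 = 0 := hγ (by simp)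
  have h10 : γ 1 0 = 0 := hγ (by simp)
  have hm : γ.map (algebraMap k⟦X⟧ k⸨X⸩) =
      !![algebraMap k⟦X⟧ k⸨X⸩ (γ 0 0), 0; 0, algebraMap k⟦X⟧ k⸨X⸩ (γ 1 1)] := by
    refine (Matrix.eta_fin_two _).trans ?_
    simp only [Matrix.map_apply, h01, h10, map_zero]
  rw [adInv, unip_inv, hm, coe_unip, coe_unip, Matrix.mul_fin_two, Matrix.mul_fin_two, map_sub]
  refine Matrix.ext fun i j => ?_
  fin_cases i <;> fin_cases j <;> simp
  ring

lemma coe_T_mul_mem_integralSet (hγ : γ.IsDiag) (t : T k) (g : GF k) :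
    (t : GF k) * g ∈ integralSet γ ↔ g ∈ integralSet γ := by
  simp only [integralSet, Set.mem_ofPred_eq, adInv_coe_T_mul hγ]

lemma mul_K_mem_integralSet (g : GF k) {κ : GF k} (hκ : κ ∈ K k) :
    g * κ ∈ integralSet γ ↔ g ∈ integralSet γ := by
  have key : ∀ (g : GF k) {κ : GF k}, κ ∈ K k → g ∈ integralSet γ → g * κ ∈ integralSet γ := by
    intro g κ hκ hg
    change adInv (g * κ) γ ∈ latticeO k
    rw [adInv_mul]
    exact mul_mem_latticeO (mul_mem_latticeO (coe_mem_latticeO (inv_mem hκ)) hg)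
      (coe_mem_latticeO hκ)
  refine ⟨fun h => ?_, key g hκ⟩
  simpa using key _ (inv_mem hκ) h

lemma unip_mem_integralSet (hγ : γ.IsDiag) {n : ℕ} (hn : (γ 0 0 - γ 1 1).order = n) (y : k⸨X⸩) :
    unip y ∈ integralSet γ ↔ poleOrder y ≤ n := by
  change adInv (unip y) γ ∈ latticeO k ↔ _
  rw [adInv_unip hγ, mem_latticeO_iff, ← mul_mem_integerRing_iff hn]
  simp only [Fin.forall_fin_two]
  have h := algebraMap_mem_integerRing (γ 0 0)
  have h' := algebraMap_mem_integerRing (γ 1 1)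
  simp [zero_mem, h, h', -map_sub, -LaurentSeries.coe_algebraMap]

lemma mem_springerFiber_iff (g : GF k) :
    (g : Grassmannian k) ∈ springerFiber γ ↔ g ∈ integralSet γ := by
  refine ⟨?_, fun h => ⟨g, rfl, h⟩⟩
  rintro ⟨h, hg, hh⟩
  obtain ⟨κ, hκ, rfl⟩ := coe_eq_coe_iff.1 hg
  exact (mul_K_mem_integralSet h hκ).2 hh

lemma not_isRegularMatrix_scalar (a : k) :
    ¬ IsRegularMatrix (algebraMap k (Matrix (Fin 2) (Fin 2) k) a) := by
  have h : Subalgebra.centralizer k {algebraMap k (Matrix (Fin 2) (Fin 2) k) a} = ⊤ := by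
    refine eq_top_iff.2 fun B _ => ?_
    rw [Subalgebra.mem_centralizer_iff]
    rintro _ rfl
    exact Algebra.commutes a B
  rw [IsRegularMatrix, h, subalgebra_top_finrank_eq_submodule_top_finrank, finrank_top,
    Module.finrank_matrix]
  simp

/-- A regular point of degree `0` is `diag(ε^b, ε^{-b}) n(y) K` with `y` of the largest possible
pole order `n`: for a smaller pole order `Ad(n(y))⁻¹ γ` is scalar modulo `ε`. -/
lemma exists_of_mem_regularPoints (hγ : γ.IsDiag) {n : ℕ} (hn : (γ 0 0 - γ 1 1).order = n)
    {x : Grassmannian k} (hx : x ∈ regularPoints γ) (hν : nuG x = 0) :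
    ∃ (b : ℤ) (y : k⸨X⸩), poleOrder y = n ∧
      x = (((cochar b (-b) : T k) * unip y : GF k) : Grassmannian k) := by
  obtain ⟨g, rfl, A, hA, hreg⟩ := hx
  obtain ⟨b, b', y, hg⟩ := exists_coe_eq_cochar_mul_unip g
  rw [hg, nuG_mk, valDet_mul, valDet_unip, add_zero, valDet_coe_T, valT_cochar] at hν
  obtain rfl : b' = -b := by
    simp at hν
    omega
  refine ⟨b, y, ?_, hg⟩
  obtain ⟨κ, hκ, hgκ⟩ := coe_eq_coe_iff.1 hg.symm
  have hle : poleOrder y ≤ n := by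
    rw [← unip_mem_integralSet hγ hn, ← coe_T_mul_mem_integralSet hγ (cochar b (-b)),
      ← mul_K_mem_integralSet _ hκ, hgκ]
    exact ⟨A, hA.symm⟩
  refine le_antisymm hle (not_lt.1 fun hlt => ?_)
  obtain ⟨m, rfl⟩ : ∃ m, n = m + 1 := ⟨n - 1, by omega⟩
  -- Write `γ₁ - γ₂ = ε δ'` and `y δ' = c` with `c` integral.
  obtain ⟨δ', hδ'⟩ : (PowerSeries.X : k⟦X⟧) ∣ γ 0 0 - γ 1 1 :=
    PowerSeries.X_dvd_iff.2 (by
      rw [← PowerSeries.coeff_zero_eq_constantCoeff_apply]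
      exact PowerSeries.coeff_of_lt_order 0 (by rw [hn]; exact_mod_cast Nat.succ_pos m))
  have hδ'm : δ'.order = m := by
    rw [hδ', PowerSeries.order_mul, PowerSeries.order_X, add_comm] at hn
    push_cast at hn
    exact ENat.add_left_injective_of_ne_top (by simp) hn
  obtain ⟨c, hc⟩ := (mul_mem_integerRing_iff hδ'm y).2 (by omega)
  have hB : adInv (unip y) γ =
      (!![γ 0 0, PowerSeries.X * c; 0, γ 1 1] : Matrix (Fin 2) (Fin 2) k⟦X⟧).map
        (algebraMap k⟦X⟧ k⸨X⸩) := by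
    rw [adInv_unip hγ, hδ']
    refine Matrix.ext fun i j => ?_
    fin_cases i <;> fin_cases j <;> simp [hc, -LaurentSeries.coe_algebraMap]
    ring
  obtain ⟨D, rfl⟩ := hκ
  have hconj : A = ((D⁻¹ : GL (Fin 2) k⟦X⟧) : Matrix (Fin 2) (Fin 2) k⟦X⟧) *
      !![γ 0 0, PowerSeries.X * c; 0, γ 1 1] * (D : Matrix (Fin 2) (Fin 2) k⟦X⟧) := by
    refine Matrix.map_injective algebraMap_injective ?_
    beta_reduce
    rw [← hA, ← hgκ, adInv_mul, adInv_coe_T_mul hγ, hB, Matrix.map_mul, Matrix.map_mul, ← map_inv]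
    rfl
  have hγ01 : PowerSeries.constantCoeff (γ 0 0) = PowerSeries.constantCoeff (γ 1 1) := by
    rw [← sub_eq_zero, ← map_sub, hδ']
    simp
  have hscal : (!![γ 0 0, PowerSeries.X * c; 0, γ 1 1] : Matrix (Fin 2) (Fin 2) k⟦X⟧).map
      (PowerSeries.constantCoeff (R := k)) =
      algebraMap k (Matrix (Fin 2) (Fin 2) k) (PowerSeries.constantCoeff (γ 1 1)) := by
    ext i j
    fin_cases i <;> fin_cases j <;> simp [hγ01, Matrix.algebraMap_matrix_apply]
  refine not_isRegularMatrix_scalar (PowerSeries.constantCoeff (γ 1 1)) ?_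
  convert hreg
  rw [hconj, Matrix.map_mul, Matrix.map_mul, hscal, ← Algebra.commutes, Matrix.mul_assoc,
    ← Matrix.map_mul, ← Units.val_mul, inv_mul_cancel, Units.val_one, Matrix.map_one _ (map_zero _) (map_one _), Matrix.mul_one]

/-- The points of the truncated fiber are `diag(ε^i, ε^{-i}) n(polarPart c) K` with `c ∈ kⁿ` and
`b - n - a + poleOrder (polarPart c) ≤ i ≤ b + a`, where `x₀ = diag(ε^b, ε^{-b}) n(y₀) K`. -/
lemma encard_truncatedFiber [Fintype k] (hγ : γ.IsDiag) {n : ℕ}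
    (hn : (γ 0 0 - γ 1 1).order = n) {x₀ : Grassmannian k} (hx₀ : x₀ ∈ regularPoints γ)
    (hν : nuG x₀ = 0) (a : ℕ) :
    (truncatedFiber γ 0 (truncPolytope x₀ a)).encard =
      ((∑ i ∈ Finset.range (n + 1), Fintype.card k ^ i + 2 * a * Fintype.card k ^ n : ℕ) : ℕ∞) := by
  obtain ⟨b, y₀, hy₀, rfl⟩ := exists_of_mem_regularPoints hγ hn hx₀ hν
  let S : Finset ((_ : Fin n → k) × ℤ) := Finset.univ.sigma fun c =>
    Finset.Icc (b - n - a + poleOrder (polarPart c)) (b + a)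
  let Φ : ((_ : Fin n → k) × ℤ) → Grassmannian k := fun z =>
    (((cochar z.2 (-z.2) : T k) * unip (polarPart z.1) : GF k) : Grassmannian k)
  have hΦ : Function.Injective Φ := by
    rintro ⟨c, i⟩ ⟨d, j⟩ h
    have hij := congrArg (fun x => retraction 1 x 0) h
    simp only [Φ, retraction_one, valT_cochar, Matrix.cons_val_zero] at hij
    subst hij
    obtain rfl := polarPart_inj (coe_mul_unip_eq_iff.1 h.symm)
    rfl
  have hsub : ∀ (i : ℤ) (y : k⸨X⸩),
      Ec (((cochar i (-i) : T k) * unip y : GF k) : Grassmannian k) ⊆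
        truncPolytope (((cochar b (-b) : T k) * unip y₀ : GF k) : Grassmannian k) a ↔
      b - n - a + poleOrder y ≤ i ∧ i ≤ b + a := by
    intro i y
    have h0 : (0 : ℝ) ≤ poleOrder y := (poleOrder y).cast_nonneg
    rw [Ec_cochar, truncPolytope_cochar, antidiagSegment_subset_iff (by linarith), hy₀,
      le_sub_iff_add_le]
    refine and_congr ?_ ?_
    · exact_mod_cast Iff.rfl
    · exact_mod_cast Iff.rfl
  have himg : truncatedFiber γ 0
      (truncPolytope (((cochar b (-b) : T k) * unip y₀ : GF k) : Grassmannian k) a) = Φ '' S := by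
    ext x
    constructor
    · rintro ⟨h1, h2, h3⟩
      obtain ⟨g, rfl⟩ := QuotientGroup.mk_surjective x
      obtain ⟨i, i', y, hg⟩ := exists_coe_eq_cochar_mul_unip g
      rw [hg] at h1 h2 h3
      rw [nuG_mk, valDet_mul, valDet_unip, add_zero, valDet_coe_T, valT_cochar] at h2
      obtain rfl : i' = -i := by
        simp at h2
        omega
      rw [mem_springerFiber_iff, coe_T_mul_mem_integralSet hγ, unip_mem_integralSet hγ hn] at h1
      obtain ⟨c, hc⟩ := exists_polarPart h1
      have hp : poleOrder y = poleOrder (polarPart c) := by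
        rw [← poleOrder_add_of_mem (x := polarPart c) hc, add_sub_cancel]
      refine ⟨⟨c, i⟩, ?_, ?_⟩
      · rw [hsub, hp] at h3
        simpa [S] using h3
      · exact (coe_mul_unip_eq_iff.2 hc).trans hg.symm
    · rintro ⟨⟨c, i⟩, hz, rfl⟩
      refine ⟨?_, ?_, (hsub _ _).2 (by simpa [S] using hz)⟩
      · rw [mem_springerFiber_iff, coe_T_mul_mem_integralSet hγ, unip_mem_integralSet hγ hn]
        exact poleOrder_polarPart_le c
      · rw [nuG_mk, valDet_mul, valDet_unip, valDet_coe_T, valT_cochar]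
        simp
  rw [himg, hΦ.encard_image, Set.encard_coe_eq_coe_finsetCard, Finset.card_sigma]
  congr 1
  have hcard : ∀ c : Fin n → k,
      (Finset.Icc (b - n - a + poleOrder (polarPart c) : ℤ) (b + a)).card +
        poleOrder (polarPart c) = n + 2 * a + 1 := by
    intro c
    have := poleOrder_polarPart_le c
    rw [Int.card_Icc]
    omega
  have hsum := Finset.sum_congr rfl fun (c : Fin n → k) (_ : c ∈ Finset.univ) => hcard c
  rw [Finset.sum_add_distrib] at hsum
  have hq := sum_poleOrder (k := k) n
  simp only [Finset.sum_const, Finset.card_univ, Fintype.card_fun, Fintype.card_fin,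
    smul_eq_mul] at hsum
  rw [Finset.sum_range_succ]
  refine Nat.add_right_cancel (m := ∑ c : Fin n → k, poleOrder (polarPart c)) ?_
  rw [hsum]
  linear_combination -hq

end Springer

/-! ### Topology of `G(F)` -/

section Topology

variable {k : Type*} [Field k]

lemma isOpen_integerRing : IsOpen (integerRing k : Set k⸨X⸩) := by
  have h : (integerRing k : Set k⸨X⸩) = {x | Valued.v x ≤ 1} :=
    Set.ext fun x => mem_integerRing_iff_val
  rw [h]
  exact Valued.isOpen_integer k⸨X⸩

lemma mem_K_iff_inv {g : GF k} : g ∈ K k ↔ (g : Matrix (Fin 2) (Fin 2) k⸨X⸩) ∈ latticeO k ∧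
    ((g⁻¹ : GF k) : Matrix (Fin 2) (Fin 2) k⸨X⸩) ∈ latticeO k := by
  refine ⟨fun h => ⟨coe_mem_latticeO h, coe_mem_latticeO (inv_mem h)⟩, fun ⟨h1, h2⟩ => ?_⟩
  have key : ∀ g : GF k, (g : Matrix (Fin 2) (Fin 2) k⸨X⸩) ∈ latticeO k → 0 ≤ valDet g := by
    intro g hg
    rw [mem_latticeO_iff] at hg
    rw [valDet, ← mem_integerRing_iff_order, Matrix.det_fin_two]
    exact sub_mem (mul_mem (hg _ _) (hg _ _)) (mul_mem (hg _ _) (hg _ _))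
  refine mem_K_of_valDet h1 ?_
  have h3 := valDet_mul g g⁻¹
  have h4 : valDet (1 : GF k) = 0 := valDet_of_mem_K (one_mem _)
  rw [mul_inv_cancel] at h3
  linarith [key _ h1, key _ h2]

lemma isOpen_K : IsOpen (K k : Set (GF k)) := by
  have hl : IsOpen (latticeO k) := by
    have h : latticeO k = ⋂ i, ⋂ j, (fun M : Matrix (Fin 2) (Fin 2) k⸨X⸩ => M i j) ⁻¹'
        (integerRing k : Set k⸨X⸩) := by
      ext M
      simp [mem_latticeO_iff]
    rw [h]
    exact isOpen_iInter_of_finite fun i => isOpen_iInter_of_finite fun j =>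
      isOpen_integerRing.preimage (continuous_id.matrix_elem i j)
  have h : (K k : Set (GF k)) = (fun g : GF k => (g : Matrix (Fin 2) (Fin 2) k⸨X⸩)) ⁻¹' latticeO k ∩
      (fun g : GF k => ((g⁻¹ : GF k) : Matrix (Fin 2) (Fin 2) k⸨X⸩)) ⁻¹' latticeO k := by
    ext g
    exact mem_K_iff_inv
  rw [h]
  exact (hl.preimage Units.continuous_val).inter (hl.preimage Units.continuous_coe_inv)

lemma isOpen_of_mul_K {S : Set (GF k)} (h : ∀ g ∈ S, ∀ κ ∈ K k, g * κ ∈ S) : IsOpen S := by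
  refine isOpen_iff_mem_nhds.2 fun g hg => ?_
  have ho : IsOpen ((fun h : GF k => g⁻¹ * h) ⁻¹' (K k : Set (GF k))) :=
    isOpen_K.preimage (continuous_const.mul continuous_id)
  refine Filter.mem_of_superset (ho.mem_nhds (by simp [one_mem])) fun x hx => ?_
  have := h g hg _ hx
  rwa [mul_inv_cancel_left] at this

lemma measurable_of_mul_K {α : Type*} [MeasurableSpace α] {F : GF k → α}
    (h : ∀ g, ∀ κ ∈ K k, F (g * κ) = F g) : Measurable F := fun S _ =>
  (isOpen_of_mul_K fun g hg κ hκ => by rwa [Set.mem_preimage, h g κ hκ]).measurableSet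

/-- The countable field of rational functions is dense in `F`, and the value group is countable. -/
instance secondCountableTopology_laurentSeries [Finite k] : SecondCountableTopology k⸨X⸩ := by
  have hc : Countable (RatFunc k) := by
    have : Countable (Polynomial k) := by
      rw [← Cardinal.mk_le_aleph0_iff]
      exact Polynomial.cardinalMk_le_max.trans (max_le Cardinal.mk_le_aleph0 le_rfl)
    exact (IsLocalization.mk'_surjective (nonZeroDivisors (Polynomial k))
      (S := RatFunc k)).countable
  have : TopologicalSpace.SeparableSpace k⸨X⸩ :=
    (LaurentSeries.coe_range_dense (K := k)).separableSpace'
  have : Countable (WithZero (Multiplicative ℤ)) := inferInstanceAs (Countable (Option ℤ))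
  have : Countable (MonoidWithZeroHom.ofClass (Valued.v : Valuation k⸨X⸩ _)).ValueGroup₀ :=
    MonoidWithZeroHom.ValueGroup₀.embedding_injective.countable
  have : Countable (MonoidWithZeroHom.ofClass (Valued.v : Valuation k⸨X⸩ _)).ValueGroup₀ˣ :=
    Units.val_injective.countable
  have : (nhds (0 : k⸨X⸩)).IsCountablyGenerated :=
    (Valued.hasBasis_nhds_zero k⸨X⸩ (WithZero (Multiplicative ℤ))).isCountablyGenerated
  have : (uniformity k⸨X⸩).IsCountablyGenerated :=
    IsUniformAddGroup.uniformity_countably_generated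
  exact UniformSpace.secondCountable_of_separable k⸨X⸩

instance secondCountableTopology_GF [Finite k] : SecondCountableTopology (GF k) := by
  have : SecondCountableTopology (Matrix (Fin 2) (Fin 2) k⸨X⸩) :=
    inferInstanceAs (SecondCountableTopology (Fin 2 → Fin 2 → k⸨X⸩))
  have : SecondCountableTopology (Matrix (Fin 2) (Fin 2) k⸨X⸩)ᵐᵒᵖ :=
    MulOpposite.opHomeomorph.symm.secondCountableTopology
  exact Units.isEmbedding_embedProduct.secondCountableTopology

end Topology

/-! ### Integration over `T(F)\G(F)` -/

section Measure

variable {k : Type*} [Field k]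

variable (k) in
/-- The set `N(F) K` of the `g ∈ G(F)` whose Iwasawa decomposition has torus part in `T(𝒪)`. -/
def unipotentK : Set (GF k) := {g | retraction 1 (g : Grassmannian k) = 0}

lemma unipotentK_mul_K {g : GF k} {κ : GF k} (hκ : κ ∈ K k) :
    g * κ ∈ unipotentK k ↔ g ∈ unipotentK k := by
  rw [unipotentK, Set.mem_ofPred_eq, Set.mem_ofPred_eq, coe_mul_K g hκ]

lemma measurableSet_unipotentK : MeasurableSet (unipotentK k) :=
  (isOpen_of_mul_K fun _ hg _ hκ => (unipotentK_mul_K hκ).2 hg).measurableSet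

lemma unip_mem_unipotentK (y : k⸨X⸩) : unip y ∈ unipotentK k := by
  have h := retraction_one 1 y
  rw [OneMemClass.coe_one, one_mul] at h
  rw [unipotentK, Set.mem_ofPred_eq, h]
  funext i
  fin_cases i <;> simp [valT]

lemma coe_T_mul_mem_unipotentK_iff (t t₀ : T k) (y : k⸨X⸩) {κ : GF k} (hκ : κ ∈ K k) :
    (t : GF k) * (t₀ * unip y * κ) ∈ unipotentK k ↔ t₀ * t ∈ TO k := by
  have h : (t : GF k) * (t₀ * unip y * κ) = ((t₀ * t : T k) : GF k) * unip y * κ := by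
    rw [T_mul_comm]
    simp [mul_assoc]
  rw [h, unipotentK_mul_K hκ, unipotentK, Set.mem_ofPred_eq, retraction_one, TO,
    Subgroup.mem_subgroupOf]
  obtain ⟨p, s, hps⟩ := exists_eq_diagT (t₀ * t)
  rw [hps, diagT_mem_K, valT_diagT]
  constructor
  · intro h
    exact ⟨congrFun h 0, congrFun h 1⟩
  · rintro ⟨h1, h2⟩
    rw [h1, h2]
    funext i
    fin_cases i <;> rfl

lemma exists_unip_mul_of_mem_unipotentK {g : GF k} (hg : g ∈ unipotentK k) :
    ∃ y, ∃ κ ∈ K k, g = unip y * κ := by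
  obtain ⟨t, y, κ, hκ, rfl⟩ := exists_iwasawa g
  have h := (coe_T_mul_mem_unipotentK_iff 1 t y hκ).1 (by simpa using hg)
  rw [mul_one, TO, Subgroup.mem_subgroupOf] at h
  obtain ⟨p, s, rfl⟩ := exists_eq_diagT t
  exact ⟨_, _, mul_mem h hκ, by rw [diagT_mul_unip, mul_assoc]⟩

lemma isOpen_TO : IsOpen (TO k : Set (T k)) := isOpen_K.preimage continuous_subtype_val

lemma lintegral_indicator_unipotentK (dt : Measure (T k)) [dt.IsHaarMeasure]
    (hdt : dt (TO k : Set (T k)) = 1) (g : GF k) :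
    ∫⁻ t : T k, (unipotentK k).indicator 1 ((t : GF k) * g) ∂dt = 1 := by
  obtain ⟨t₀, y, κ, hκ, rfl⟩ := exists_iwasawa g
  have h : (fun t : T k => (unipotentK k).indicator (1 : GF k → ℝ≥0∞)
      ((t : GF k) * (t₀ * unip y * κ))) =
      ((fun t : T k => t₀ * t) ⁻¹' (TO k : Set (T k))).indicator 1 := by
    classical
    funext t
    simp only [Set.indicator_apply, Set.mem_preimage, SetLike.mem_coe,
      coe_T_mul_mem_unipotentK_iff t t₀ y hκ]
    rfl
  rw [h, lintegral_indicator_one (isOpen_TO.preimage (continuous_const_mul t₀)).measurableSet,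
    measure_preimage_mul, hdt]

lemma lintegral_indicator_unipotentK_inv (dt : Measure (T k)) [dt.IsHaarMeasure]
    (hdt : dt (TO k : Set (T k)) = 1) (g : GF k) :
    ∫⁻ t : T k, (unipotentK k).indicator 1 ((t : GF k)⁻¹ * g) ∂dt = 1 := by
  obtain ⟨t₀, y, κ, hκ, rfl⟩ := exists_iwasawa g
  have h : (fun t : T k => (unipotentK k).indicator (1 : GF k → ℝ≥0∞)
      ((t : GF k)⁻¹ * (t₀ * unip y * κ))) =
      ((fun t : T k => t₀⁻¹ * t) ⁻¹' (TO k : Set (T k))).indicator 1 := by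
    classical
    funext t
    have h1 := coe_T_mul_mem_unipotentK_iff t⁻¹ t₀ y hκ
    rw [← inv_mem_iff, mul_inv_rev, inv_inv, T_mul_comm] at h1
    simp only [Set.indicator_apply, Set.mem_preimage, SetLike.mem_coe, ← h1]
    rfl
  rw [h, lintegral_indicator_one (isOpen_TO.preimage (continuous_const_mul t₀⁻¹)).measurableSet,
    measure_preimage_mul, hdt]

/-- A left-invariant measure that is finite on some nonempty open set is locally finite. -/
lemma isLocallyFiniteMeasure_of_isOpen {H : Type*} [Group H] [TopologicalSpace H]
    [IsTopologicalGroup H] [MeasurableSpace H] [BorelSpace H] (μ : Measure H)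
    [μ.IsMulLeftInvariant] {U : Set H} (hU : IsOpen U) (h1 : (1 : H) ∈ U) (hμ : μ U ≠ ∞) :
    IsLocallyFiniteMeasure μ := by
  refine ⟨fun g => ⟨(fun h => g⁻¹ * h) ⁻¹' U,
    (hU.preimage (continuous_const_mul g⁻¹)).mem_nhds (by simpa using h1), ?_⟩⟩
  rw [measure_preimage_mul]
  exact hμ.lt_top

/-- The quotient measure exists: it is the image of the restriction of `dg` to `N(F) K`, because
the characteristic function of `N(F) K` has integral `1` over each coset of `T(F)`. -/
lemma exists_isQuotientMeasure [Finite k] (dg : Measure (GF k)) [dg.IsHaarMeasure]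
    (hdg : dg (K k : Set (GF k)) = 1) (dt : Measure (T k)) [dt.IsHaarMeasure]
    (hdt : dt (TO k : Set (T k)) = 1) : ∃ μ, IsQuotientMeasure dg dt μ := by
  have : IsLocallyFiniteMeasure dg :=
    isLocallyFiniteMeasure_of_isOpen dg isOpen_K (one_mem _) (by simp [hdg])
  have : IsLocallyFiniteMeasure dt :=
    isLocallyFiniteMeasure_of_isOpen dt isOpen_TO (one_mem _) (by simp [hdt])
  have : SecondCountableTopology (T k) :=
    Topology.IsEmbedding.subtypeVal.secondCountableTopology
  have hS := measurableSet_unipotentK (k := k)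
  obtain ⟨χ, hχ⟩ : ∃ χ, χ = (unipotentK k).indicator (1 : GF k → ℝ≥0∞) := ⟨_, rfl⟩
  have hχm : Measurable χ := hχ ▸ measurable_one.indicator hS
  have hχ1 : ∀ g, ∫⁻ t : T k, χ ((t : GF k)⁻¹ * g) ∂dt = 1 := fun g =>
    hχ ▸ lintegral_indicator_unipotentK_inv dt hdt g
  refine ⟨(dg.restrict (unipotentK k)).map (Quotient.mk _), fun f hf φ hφ => ?_⟩
  have hmul : Measurable fun p : GF k × T k => f ((p.2 : GF k) * p.1) := by
    have : Continuous fun p : GF k × T k => (p.2 : GF k) * p.1 :=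
      (continuous_subtype_val.comp continuous_snd).mul continuous_fst
    exact hf.comp this.measurable
  have hinv : Measurable fun p : GF k × T k => χ ((p.2 : GF k)⁻¹ * p.1) := by
    have : Continuous fun p : GF k × T k => (p.2 : GF k)⁻¹ * p.1 :=
      (continuous_subtype_val.comp continuous_snd).inv.mul continuous_fst
    exact hχm.comp this.measurable
  have hmk : Measurable (Quotient.mk (QuotientGroup.rightRel (T k))) := measurable_quotient_mk''
  have hφm : Measurable φ := by
    refine measurable_from_quotient.2 ?_
    change Measurable fun g => φ (Quotient.mk (QuotientGroup.rightRel (T k)) g)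
    simp only [hφ]
    exact Measurable.lintegral_prod_right' hmul
  have hsplit : Measurable fun p : GF k × T k => f p.1 * χ ((p.2 : GF k)⁻¹ * p.1) :=
    Measurable.mul (hf.comp measurable_fst) hinv
  have hsplit' : Measurable fun p : GF k × T k => f ((p.2 : GF k) * p.1) * χ p.1 :=
    Measurable.mul hmul (hχm.comp measurable_fst)
  rw [lintegral_map hφm hmk, ← lintegral_indicator hS]
  calc ∫⁻ g, f g ∂dg
      = ∫⁻ g, ∫⁻ t : T k, f g * χ ((t : GF k)⁻¹ * g) ∂dt ∂dg := by
        refine lintegral_congr fun g => ?_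
        have hc : Continuous fun t : T k => (t : GF k)⁻¹ * g :=
          continuous_subtype_val.inv.mul continuous_const
        have hg : Measurable fun t : T k => χ ((t : GF k)⁻¹ * g) := hχm.comp hc.measurable
        rw [lintegral_const_mul _ hg, hχ1, mul_one]
    _ = ∫⁻ t : T k, ∫⁻ g, f g * χ ((t : GF k)⁻¹ * g) ∂dg ∂dt :=
        lintegral_lintegral_swap hsplit.aemeasurable
    _ = ∫⁻ t : T k, ∫⁻ g, f ((t : GF k) * g) * χ g ∂dg ∂dt := by
        refine lintegral_congr fun t => ?_
        rw [← lintegral_mul_left_eq_self _ (t : GF k)]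
        simp only [inv_mul_cancel_left]
    _ = ∫⁻ g, ∫⁻ t : T k, f ((t : GF k) * g) * χ g ∂dt ∂dg :=
        (lintegral_lintegral_swap hsplit'.aemeasurable).symm
    _ = ∫⁻ g, (unipotentK k).indicator (fun g => φ (Quotient.mk _ g)) g ∂dg := by
        refine lintegral_congr fun g => ?_
        by_cases hg : g ∈ unipotentK k
        · simp [hg, hφ, hχ]
        · simp [hg, hχ]

/-- Integration over `T(F)\G(F)` is integration over `N(F) K`. -/
lemma torusIntegral_eq_lintegral [Finite k] (dg : Measure (GF k)) [dg.IsHaarMeasure]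
    (hdg : dg (K k : Set (GF k)) = 1) (dt : Measure (T k)) [dt.IsHaarMeasure]
    (hdt : dt (TO k : Set (T k)) = 1) {F : GF k → ℝ≥0∞} (hF : Measurable F)
    (hT : ∀ (t : T k) (g : GF k), F ((t : GF k) * g) = F g) :
    torusIntegral dg dt F = ∫⁻ g, (unipotentK k).indicator F g ∂dg := by
  have h := exists_isQuotientMeasure dg hdg dt hdt
  have hq : IsQuotientMeasure dg dt (quotientMeasure dg dt) := by
    rw [quotientMeasure, dif_pos h]
    exact h.choose_spec
  have h1S : Measurable ((unipotentK k).indicator (1 : GF k → ℝ≥0∞)) :=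
    measurable_one.indicator measurableSet_unipotentK
  refine (hq _ (hF.indicator measurableSet_unipotentK) (fun x => F x.out) fun g => ?_).symm
  have hout : F (Quotient.out (Quotient.mk (QuotientGroup.rightRel (T k)) g)) = F g := by
    have hr := QuotientGroup.rightRel_apply.1 (Quotient.mk_out (s := QuotientGroup.rightRel (T k)) g)
    have := hT ⟨_, hr⟩ (Quotient.out (Quotient.mk (QuotientGroup.rightRel (T k)) g))
    simpa using this.symm
  have hmul : Measurable fun t : T k => (t : GF k) * g :=
    (continuous_subtype_val.mul continuous_const).measurable
  calc F (Quotient.out (Quotient.mk (QuotientGroup.rightRel (T k)) g))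
      = F g * ∫⁻ t : T k, (unipotentK k).indicator 1 ((t : GF k) * g) ∂dt := by
        rw [hout, lintegral_indicator_unipotentK dt hdt, mul_one]
    _ = ∫⁻ t : T k, F g * (unipotentK k).indicator 1 ((t : GF k) * g) ∂dt :=
        (lintegral_const_mul _ (h1S.comp hmul)).symm
    _ = ∫⁻ t : T k, (unipotentK k).indicator F ((t : GF k) * g) ∂dt := by
        refine lintegral_congr fun t => ?_
        by_cases hg : (t : GF k) * g ∈ unipotentK k
        · simp [hg, hT]
        · simp [hg]

/-- For a right `K`-invariant function, the integral over `T(F)\G(F)` is the sum over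
`N(F) K / K = F / 𝒪`; the support condition restricts it to `ε^{-n}𝒪 / 𝒪`. -/
lemma torusIntegral_eq_sum [Fintype k] (dg : Measure (GF k)) [dg.IsHaarMeasure]
    (hdg : dg (K k : Set (GF k)) = 1) (dt : Measure (T k)) [dt.IsHaarMeasure]
    (hdt : dt (TO k : Set (T k)) = 1) {F : GF k → ℝ≥0∞}
    (hT : ∀ (t : T k) (g : GF k), F ((t : GF k) * g) = F g)
    (hK : ∀ g, ∀ κ ∈ K k, F (g * κ) = F g) {n : ℕ}
    (hn : ∀ y : k⸨X⸩, n < poleOrder y → F (unip y) = 0) :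
    torusIntegral dg dt F = ∑ c : Fin n → k, F (unip (polarPart c)) := by
  rw [torusIntegral_eq_lintegral dg hdg dt hdt (measurable_of_mul_K hK) hT]
  let C : (Fin n → k) → Set (GF k) := fun c =>
    (fun g => (unip (polarPart c))⁻¹ * g) ⁻¹' (K k : Set (GF k))
  have hC : ∀ c, MeasurableSet (C c) := fun c =>
    (isOpen_K.preimage (continuous_const_mul _)).measurableSet
  have hmem : ∀ c g, g ∈ C c ↔ ((unip (polarPart c) : GF k) : Grassmannian k) = g :=
    fun c g => QuotientGroup.eq.symm
  have hunip : ∀ y z : k⸨X⸩, ((unip y : GF k) : Grassmannian k) = (unip z : GF k) ↔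
      z - y ∈ integerRing k := by
    intro y z
    simpa using coe_mul_unip_eq_iff (g := 1) (y := y) (z := z)
  have hsum : ∀ g, (unipotentK k).indicator F g =
      ∑ c, (C c).indicator (fun _ => F (unip (polarPart c))) g := by
    intro g
    by_cases hex : ∃ c, g ∈ C c
    · obtain ⟨c, hc⟩ := hex
      obtain ⟨κ, hκ, rfl⟩ := coe_eq_coe_iff.1 ((hmem c g).1 hc)
      rw [Finset.sum_eq_single c, Set.indicator_of_mem hc, Set.indicator_of_mem, hK _ _ hκ]
      · exact (unipotentK_mul_K hκ).2 (unip_mem_unipotentK _)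
      · intro d _ hd
        refine Set.indicator_of_notMem (fun hd' => hd ?_) _
        exact (polarPart_inj ((hunip _ _).1
          (((hmem d _).1 hd').trans ((hmem c _).1 hc).symm))).symm
      · simp
    · rw [Finset.sum_eq_zero fun c _ => Set.indicator_of_notMem (fun h => hex ⟨c, h⟩) _]
      by_cases hg : g ∈ unipotentK k
      · obtain ⟨y, κ, hκ, rfl⟩ := exists_unip_mul_of_mem_unipotentK hg
        rw [Set.indicator_of_mem hg, hK _ _ hκ]
        refine hn y (not_le.1 fun hy => hex ?_)
        obtain ⟨c, hc⟩ := exists_polarPart hy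
        exact ⟨c, by rw [hmem, coe_mul_K _ hκ, hunip]; exact hc⟩
      · exact Set.indicator_of_notMem hg _
  rw [lintegral_congr hsum, lintegral_finsetSum _ fun c _ => measurable_const.indicator (hC c)]
  refine Finset.sum_congr rfl fun c _ => ?_
  rw [lintegral_indicator_const (hC c), measure_preimage_mul, hdg, mul_one]

end Measure

end GL2Split

/-! ### The orbital integral, the truncated fiber and the weighted orbital integral -/

theorem mainTheorem6 {k : Type*} [Field k] [Fintype k]
    (dg : Measure (GL2Split.GF k)) [dg.IsHaarMeasure]
    (hdg : dg (GL2Split.K k : Set (GL2Split.GF k)) = 1)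
    (dt : Measure (GL2Split.T k)) [dt.IsHaarMeasure]
    (hdt : dt (GL2Split.TO k : Set (GL2Split.T k)) = 1)
    (γ : Matrix (Fin 2) (Fin 2) k⟦X⟧) (hγ : γ.IsDiag)
    (n : ℕ) (hn : (γ 0 0 - γ 1 1).order = n) :
    GL2Split.orbitalIntegral dg dt γ = (Fintype.card k : ℝ≥0∞) ^ n ∧
    (∀ x₀ ∈ GL2Split.regularPoints γ, GL2Split.nuG x₀ = 0 → ∀ a : ℕ,
      (GL2Split.truncatedFiber γ 0 (GL2Split.truncPolytope x₀ a)).encard =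
        ((∑ i ∈ Finset.range (n + 1), Fintype.card k ^ i +
          2 * a * Fintype.card k ^ n : ℕ) : ℕ∞)) ∧
    (∀ ξ : Fin 2 → ℝ, GL2Split.IsGenericXi ξ →
      GL2Split.weightedOrbitalIntegral dg dt ξ γ ≠ ∞ ∧
      (GL2Split.weightedOrbitalIntegral dg dt ξ γ).toReal =
        (n : ℝ) * (Fintype.card k : ℝ) ^ n -
          ∑ i ∈ Finset.range n, (Fintype.card k : ℝ) ^ i) := by
  classical
  have hT := GL2Split.coe_T_mul_mem_integralSet hγ
  have hK := fun g κ (hκ : κ ∈ GL2Split.K k) => GL2Split.mul_K_mem_integralSet (γ := γ) g hκ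
  have hU := GL2Split.unip_mem_integralSet hγ hn
  refine ⟨?_, fun x₀ hx₀ hν a => GL2Split.encard_truncatedFiber hγ hn hx₀ hν a, fun ξ hξ => ?_⟩
  · rw [GL2Split.orbitalIntegral, GL2Split.torusIntegral_eq_sum dg hdg dt hdt (n := n)]
    · have h : ∀ c : Fin n → k, (GL2Split.integralSet γ).indicator (1 : GL2Split.GF k → ℝ≥0∞)
          (GL2Split.unip (GL2Split.polarPart c)) = 1 := fun c =>
        Set.indicator_of_mem ((hU _).2 (GL2Split.poleOrder_polarPart_le c)) _
      simp [h]
    · intro t g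
      simp only [Set.indicator_apply, hT t g, Pi.one_apply]
    · intro g κ hκ
      simp only [Set.indicator_apply, hK g κ hκ, Pi.one_apply]
    · intro y hy
      exact Set.indicator_of_notMem (fun h => hy.not_ge ((hU y).1 h)) _
  · have hJ : GL2Split.weightedOrbitalIntegral dg dt ξ γ =
        ((∑ c : Fin n → k, GL2Split.poleOrder (GL2Split.polarPart c) : ℕ) : ℝ≥0∞) := by
      rw [GL2Split.weightedOrbitalIntegral,
        GL2Split.torusIntegral_eq_sum dg hdg dt hdt (n := n), Nat.cast_sum]
      · refine Finset.sum_congr rfl fun c _ => ?_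
        rw [Set.indicator_of_mem ((hU _).2 (GL2Split.poleOrder_polarPart_le c)),
          GL2Split.weight_unip hξ]
      · intro t g
        simp only [Set.indicator_apply, hT t g, GL2Split.weight_coe_T_mul]
      · intro g κ hκ
        simp only [Set.indicator_apply, hK g κ hκ, GL2Split.weight_mul_K ξ g hκ]
      · intro y hy
        exact Set.indicator_of_notMem (fun h => hy.not_ge ((hU y).1 h)) _
    rw [hJ]
    refine ⟨ENNReal.natCast_ne_top _, ?_⟩
    rw [ENNReal.toReal_natCast, eq_sub_iff_add_eq]
    exact_mod_cast GL2Split.sum_poleOrder (k := k) n
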